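/- **Setting.** Let $\mathcal V\subseteq\mathbf{Cat}$ be a full sub-2-category of the 2-category of small categories, closed in $\mathbf{Cat}$ under small limits and exponentials, having small colimits, and containing the arrow category $\mathbf 2$ (for example $\mathbf{Cat}$, preorders, or posets). For a $\mathcal V$-category $\mathcal C$, $\mathcal C^{\mathbf 2}$ is the $\mathcal V$-category of arrows of $\mathcal C$, with $\mathcal C^{\mathbf 2}(f,g)$ the pullback of $\mathcal C(\mathrm{dom} f,\mathrm{dom} g)\to\mathcal C(\mathrm{dom} f,\mathrm{cod} g)\leftarrow\mathcal C(\mathrm{cod} f,\mathrm{cod} g)$. A *$\mathcal V$-enriched AWFS* $(\mathsf E,\mathsf M)$ on $\mathcal C$ consists of a $\mathcal V$-functor $K:\mathcal C^{\mathbf 2}\to\mathcal C$ and $\mathcal V$-natural $\lambda:\mathrm{dom}\Rightarrow K$, $\rho:K\Rightarrow\mathrm{cod}$ with $\rho_f\lambda_f=f$; a comonad structure $\mathsf E$ on the endo-$\mathcal V$-functor $f\mapsto\lambda_f$ of $\mathcal C^{\mathbf 2}$, with counit $(1,\rho_f)$ and comultiplication $(1,\sigma_f)$; and a monad structure $\mathsf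 M$ on $f\mapsto\rho_f$, with unit $(\lambda_f,1)$ and multiplication $(\pi_f,1)$; such that $(\sigma_f,\pi_f):\lambda_{\rho_f}\to\rho_{\lambda_f}$ is a mixed distributive law. It is *cocontinuous* if $K$ preserves small colimits. An $\mathsf M$-algebra is an arrow $g$ with a structure map $p:Kg\to\mathrm{dom}\,g$ such that $(p,1):\rho_g\to g$ satisfies the algebra axioms; for any AWFS such algebras compose canonically: for algebras $(f,p)$, $(g,q)$ with $\mathrm{cod} f=\mathrm{dom} g$, the structure on $gf$ is $p\cdot K(1,\,q\cdot K(f,1))\cdot\sigma_{gf}$. They can also be pulled back, uniquely so that the pullback square is an algebra morphism. Let $\mathbb J=(\mathcal J\rightrightarrows\mathcal J_0)$ be a small category internal to the category of small $\mathcal V$-categories, and $U:\mathbb J\to\mathbb{S}\mathrm{q}(\mathcal C)$ an internal functor to the internal category of squares $\mathcal C^{\mathbf 2}\rightrightarrows\mathcal C$. Let $(\mathsf E,\mathsf M)$ be a $\mathcal V$-enriched AWFS on $\mathcal V$. For $f:X\to Y$ in $\mathcal C$ and $i\in\mathcal J$ put $$W_i(f)=\mathcal C^{\mathbf 2}(Ui,(1,f)):\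 \mathcal C(\mathrm{cod}\,Ui,X)\cong\mathcal C^{\mathbf 2}(Ui,1_X)\longrightarrow\mathcal C^{\mathbf 2}(Ui,f),\qquad k\mapsto(k\cdot Ui,\ f\cdot k).$$ An object of the $\mathcal V$-category $\mathbb J^{\pitchfork\!\!\!\pitchfork_{\mathsf M}}$ is an arrow $f$ of $\mathcal C$ with an $\mathsf M$-algebra structure $p_i$ on each $W_i(f)$, $\mathcal V$-natural in $i$, such that for all vertically composable $i$ and $j$ the structure at $j\bullet i$ is that of the composite algebra $$\mathcal C(\mathrm{cod}\,Uj,X)\xrightarrow{\,W_j(f)\,}\mathcal C^{\mathbf 2}(Uj,f)\longrightarrow\mathcal C^{\mathbf 2}(Uj\cdot Ui,f),$$ where the second arrow $(h,k)\mapsto(h\cdot Ui,k)$ is the pullback of $W_i(f)$ along $\mathcal C^{\mathbf 2}(Uj\cdot Ui,f)\to\mathcal C^{\mathbf 2}(Ui,f)$, $(h,k)\mapsto(h,k\cdot Uj)$, and carries the pulled-back algebra structure. The hom-object from $(f,p)$ to $(g,q)$ is the equaliser in $\mathcal V$ of $\mathcal C^{\mathbf 2}(f,g)\rightrightarrows\prod_i[K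 W_i(f),\mathcal C(\mathrm{cod}\,Ui,\mathrm{dom}\,g)]$ that expresses compatibility with the algebra structures. There is an evident forgetful functor $\mathbb J^{\pitchfork\!\!\!\pitchfork_{\mathsf M}}\to\mathcal C^{\mathbf 2}$. An orthogonal factorisation system $(\mathcal E,\mathcal M)$ is *proper* if $\mathcal E$ consists of epimorphisms and $\mathcal M$ of monomorphisms. A category $\mathcal A$ is *locally ranked* with respect to a proper $(\mathcal E,\mathcal M)$ if it is cocomplete; for each object $X$ there is, up to isomorphism, only a small set of morphisms in $\mathcal E$ with domain $X$; and each object $A$ has a *rank*, i.e. there is a regular cardinal $\kappa$ such that $\mathcal A(A,-)$ preserves the colimit of every small $\kappa$-filtered diagram $(X_d)$ that admits a cocone $(X_d\to X)$ with components in $\mathcal M$. **Proposition.** Suppose that $\mathcal V$ is equipped with a cocontinuous $\mathcal V$-enriched AWFS $(\mathsf E,\mathsf M)$, that $\mathcal C$ is a cocomplete $\mathcal V$-category (it has small conical colimits and tensors with objects of $\mathcal V$), and that the underlying category of $\mathcal C$ is locally ranked with respect to a proper orthogonal factorisation system $(\mathcal E,\mathcal M)$. Let $\mathbb J$ be a small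 internal category in $\mathcal V$-categories over $\mathbb{S}\mathrm{q}(\mathcal C)$. Then there is a regular cardinal $\kappa$ such that the forgetful functor $\mathbb J^{\pitchfork\!\!\!\pitchfork_{\mathsf M}}\to\mathcal C^{\mathbf 2}$ creates $\kappa$-filtered colimits of $\mathcal M$-subobjects: for every small $\kappa$-filtered $\mathcal D$ and every diagram $D:\mathcal D\to\mathbb J^{\pitchfork\!\!\!\pitchfork_{\mathsf M}}$ whose image in $\mathcal C^{\mathbf 2}$ admits a cocone with components componentwise in $\mathcal M$, each colimit cocone of that image in $\mathcal C^{\mathbf 2}$ lifts to exactly one cocone under $D$, and the lifted cocone is a ($\mathcal V$-enriched) colimit of $D$. -/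

import Mathlib

open CategoryTheory Limits
open MonoidalCategory hiding tensorHom_def

namespace EnrichedAWFS

universe v₁ u₁ v₂ u₂ v₃ u₃ w

/-! ### The arrow `V`-category `C^2` -/

section Arrow

variable (V : Type u₁) [Category.{v₁} V] [MonoidalCategory V]
variable {C : Type u₂} [Category.{v₂} C] [EnrichedOrdinaryCategory V C]

lemma eComp_dinatural {A B : V} (W : C) {X Y : C} (Z : C) (g : X ⟶ Y)
    (a : A ⟶ (W ⟶[V] X)) (b : B ⟶ (Y ⟶[V] Z)) :
    (a ⊗ₘ (b ≫ eHomWhiskerRight V g Z)) ≫ eComp V W X Z =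
      ((a ≫ eHomWhiskerLeft V W g) ⊗ₘ b) ≫ eComp V W Y Z := by
  have key : (W ⟶[V] X) ◁ eHomWhiskerRight V g Z ≫ eComp V W X Z =
      eHomWhiskerLeft V W g ▷ (Y ⟶[V] Z) ≫ eComp V W Y Z := by
    simp only [eHomWhiskerRight, eHomWhiskerLeft, MonoidalCategory.whiskerLeft_comp,
      comp_whiskerRight, Category.assoc]
    rw [← e_assoc]
    simp
  have h1 : a ⊗ₘ (b ≫ eHomWhiskerRight V g Z) =
      (a ⊗ₘ b) ≫ (_ ◁ eHomWhiskerRight V g Z) := by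
    rw [← id_tensorHom, tensorHom_comp_tensorHom, Category.comp_id]
  have h2 : (a ≫ eHomWhiskerLeft V W g) ⊗ₘ b =
      (a ⊗ₘ b) ≫ (eHomWhiskerLeft V W g ▷ _) := by
    rw [← tensorHom_id, tensorHom_comp_tensorHom, Category.comp_id]
  rw [h1, h2, Category.assoc, Category.assoc, key]

lemma eHomEquiv_whiskerLeft {X Y Z : C} (f : X ⟶ Y) (g : Y ⟶ Z) :
    eHomEquiv V f ≫ eHomWhiskerLeft V X g = eHomEquiv V (f ≫ g) := by
  rw [eHomEquiv_comp, eHomWhiskerLeft, rightUnitor_inv_naturality_assoc,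
    MonoidalCategory.tensorHom_def]
  simp [unitors_inv_equal]

lemma eHomEquiv_whiskerRight {X Y Z : C} (f : X ⟶ Y) (g : Y ⟶ Z) :
    eHomEquiv V g ≫ eHomWhiskerRight V f Z = eHomEquiv V (f ≫ g) := by
  rw [eHomEquiv_comp, eHomWhiskerRight, leftUnitor_inv_naturality_assoc, tensorHom_def']
  simp

lemma aux_id_comp {A : V} (X Y : C) (a : A ⟶ (X ⟶[V] Y)) :
    (λ_ A).inv ≫ (eId V X ⊗ₘ a) ≫ eComp V X X Y = a := by
  rw [tensorHom_def', Category.assoc, ← leftUnitor_inv_naturality_assoc, e_id_comp,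
    Category.comp_id]

lemma aux_comp_id {A : V} (X Y : C) (a : A ⟶ (X ⟶[V] Y)) :
    (ρ_ A).inv ≫ (a ⊗ₘ eId V Y) ≫ eComp V X Y Y = a := by
  rw [MonoidalCategory.tensorHom_def, Category.assoc, ← rightUnitor_inv_naturality_assoc,
    e_comp_id, Category.comp_id]

lemma aux_assoc {A B D : V} (W X Y Z : C) (a : A ⟶ (W ⟶[V] X)) (b : B ⟶ (X ⟶[V] Y))
    (d : D ⟶ (Y ⟶[V] Z)) :
    (α_ A B D).inv ≫ (((a ⊗ₘ b) ≫ eComp V W X Y) ⊗ₘ d) ≫ eComp V W Y Z =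
      (a ⊗ₘ ((b ⊗ₘ d) ≫ eComp V X Y Z)) ≫ eComp V W X Z := by
  have h1 : ((a ⊗ₘ b) ≫ eComp V W X Y) ⊗ₘ d = ((a ⊗ₘ b) ⊗ₘ d) ≫ eComp V W X Y ▷ _ := by
    rw [← tensorHom_id, tensorHom_comp_tensorHom, Category.comp_id]
  have h2 : a ⊗ₘ ((b ⊗ₘ d) ≫ eComp V X Y Z) = (a ⊗ₘ (b ⊗ₘ d)) ≫ _ ◁ eComp V X Y Z := by
    rw [← id_tensorHom, tensorHom_comp_tensorHom, Category.comp_id]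
  rw [h1, h2, Category.assoc, Category.assoc, ← e_assoc, associator_inv_naturality_assoc]

variable [HasPullbacks V]

/-- The hom-object `C^2(f, g)`: the pullback of
`C(dom f, dom g) ⟶ C(dom f, cod g) ⟵ C(cod f, cod g)`. -/
noncomputable def arrowHom (f g : Arrow C) : V :=
  pullback (eHomWhiskerLeft V f.left g.hom) (eHomWhiskerRight V f.hom g.right)

/-- The projection `C^2(f, g) ⟶ C(dom f, dom g)`. -/
noncomputable def arrowFst (f g : Arrow C) : arrowHom V f g ⟶ (f.left ⟶[V] g.left) :=
  pullback.fst _ _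

/-- The projection `C^2(f, g) ⟶ C(cod f, cod g)`. -/
noncomputable def arrowSnd (f g : Arrow C) : arrowHom V f g ⟶ (f.right ⟶[V] g.right) :=
  pullback.snd _ _

lemma arrow_condition (f g : Arrow C) :
    arrowFst V f g ≫ eHomWhiskerLeft V f.left g.hom =
      arrowSnd V f g ≫ eHomWhiskerRight V f.hom g.right := pullback.condition

/-- The universal property of `C^2(f, g)`. -/
noncomputable def arrowLift {f g : Arrow C} {X : V} (a : X ⟶ (f.left ⟶[V] g.left))
    (b : X ⟶ (f.right ⟶[V] g.right))
    (h : a ≫ eHomWhiskerLeft V f.left g.hom = b ≫ eHomWhiskerRight V f.hom g.right) :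
    X ⟶ arrowHom V f g := pullback.lift a b h

@[simp]
lemma arrowLift_fst {f g : Arrow C} {X : V} (a : X ⟶ (f.left ⟶[V] g.left))
    (b : X ⟶ (f.right ⟶[V] g.right)) (h) :
    arrowLift V a b h ≫ arrowFst V f g = a := pullback.lift_fst _ _ _

@[simp]
lemma arrowLift_snd {f g : Arrow C} {X : V} (a : X ⟶ (f.left ⟶[V] g.left))
    (b : X ⟶ (f.right ⟶[V] g.right)) (h) :
    arrowLift V a b h ≫ arrowSnd V f g = b := pullback.lift_snd _ _ _

lemma arrowHom_ext {f g : Arrow C} {X : V} {a b : X ⟶ arrowHom V f g}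
    (h₁ : a ≫ arrowFst V f g = b ≫ arrowFst V f g)
    (h₂ : a ≫ arrowSnd V f g = b ≫ arrowSnd V f g) : a = b := pullback.hom_ext h₁ h₂

/-- The identity of `f` in `C^2`. -/
noncomputable def arrowId (f : Arrow C) : 𝟙_ V ⟶ arrowHom V f f :=
  arrowLift V (eId V f.left) (eId V f.right) (by
    rw [← eHomEquiv_id, ← eHomEquiv_id, eHomEquiv_whiskerLeft, eHomEquiv_whiskerRight]; simp)

/-- The composition of `C^2`, computed componentwise. -/
noncomputable def arrowComp (f g h : Arrow C) :
    arrowHom V f g ⊗ arrowHom V g h ⟶ arrowHom V f h :=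
  arrowLift V
    ((arrowFst V f g ⊗ₘ arrowFst V g h) ≫ eComp V _ _ _)
    ((arrowSnd V f g ⊗ₘ arrowSnd V g h) ≫ eComp V _ _ _) (by
      have e1 : (arrowFst V f g ⊗ₘ arrowFst V g h) ≫ _ ◁ eHomWhiskerLeft V g.left h.hom =
          arrowFst V f g ⊗ₘ (arrowSnd V g h ≫ eHomWhiskerRight V g.hom h.right) := by
        rw [← arrow_condition, ← id_tensorHom, tensorHom_comp_tensorHom, Category.comp_id]
      have e2 : (arrowSnd V f g ⊗ₘ arrowSnd V g h) ≫ eHomWhiskerRight V f.hom g.right ▷ _ =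
          (arrowFst V f g ≫ eHomWhiskerLeft V f.left g.hom) ⊗ₘ arrowSnd V g h := by
        rw [arrow_condition, ← tensorHom_id, tensorHom_comp_tensorHom, Category.comp_id]
      rw [Category.assoc, Category.assoc, eComp_eHomWhiskerLeft, eComp_eHomWhiskerRight,
        reassoc_of% e1, reassoc_of% e2, eComp_dinatural])

@[simp]
lemma arrowId_fst (f : Arrow C) : arrowId V f ≫ arrowFst V f f = eId V f.left :=
  arrowLift_fst _ _ _ _

@[simp]
lemma arrowId_snd (f : Arrow C) : arrowId V f ≫ arrowSnd V f f = eId V f.right :=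
  arrowLift_snd _ _ _ _

@[simp]
lemma arrowComp_fst (f g h : Arrow C) : arrowComp V f g h ≫ arrowFst V f h =
    (arrowFst V f g ⊗ₘ arrowFst V g h) ≫ eComp V _ _ _ :=
  arrowLift_fst _ _ _ _

@[simp]
lemma arrowComp_snd (f g h : Arrow C) : arrowComp V f g h ≫ arrowSnd V f h =
    (arrowSnd V f g ⊗ₘ arrowSnd V g h) ≫ eComp V _ _ _ :=
  arrowLift_snd _ _ _ _

/-- The element of `C^2(f, g)` given by a commutative square. -/
noncomputable def arrowElt {f g : Arrow C} (h : f ⟶ g) : 𝟙_ V ⟶ arrowHom V f g :=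
  arrowLift V (eHomEquiv V h.left) (eHomEquiv V h.right) (by
    rw [eHomEquiv_whiskerLeft, eHomEquiv_whiskerRight, Arrow.w])

@[simp]
lemma arrowElt_fst {f g : Arrow C} (h : f ⟶ g) :
    arrowElt V h ≫ arrowFst V f g = eHomEquiv V h.left := arrowLift_fst _ _ _ _

@[simp]
lemma arrowElt_snd {f g : Arrow C} (h : f ⟶ g) :
    arrowElt V h ≫ arrowSnd V f g = eHomEquiv V h.right := arrowLift_snd _ _ _ _

lemma arrowElt_id (f : Arrow C) : arrowElt V (𝟙 f) = arrowId V f := by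
  apply arrowHom_ext
  · rw [arrowElt_fst, arrowId_fst, Arrow.id_left, eHomEquiv_id]
  · rw [arrowElt_snd, arrowId_snd, Arrow.id_right, eHomEquiv_id]

lemma arrowElt_comp {f g h : Arrow C} (a : f ⟶ g) (b : g ⟶ h) :
    arrowElt V (a ≫ b) =
      (λ_ _).inv ≫ (arrowElt V a ⊗ₘ arrowElt V b) ≫ arrowComp V f g h := by
  apply arrowHom_ext
  · rw [arrowElt_fst, Category.assoc, Category.assoc, arrowComp_fst,
      tensorHom_comp_tensorHom_assoc, arrowElt_fst, arrowElt_fst, Arrow.comp_left, eHomEquiv_comp]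
  · rw [arrowElt_snd, Category.assoc, Category.assoc, arrowComp_snd,
      tensorHom_comp_tensorHom_assoc, arrowElt_snd, arrowElt_snd, Arrow.comp_right, eHomEquiv_comp]

/-- Commutative squares `f ⟶ g` are the elements of `C^2(f, g)`. -/
noncomputable def arrowHomEquiv (f g : Arrow C) : (f ⟶ g) ≃ (𝟙_ V ⟶ arrowHom V f g) where
  toFun h := arrowElt V h
  invFun h := Arrow.homMk ((eHomEquiv V).symm (h ≫ arrowFst V f g))
    ((eHomEquiv V).symm (h ≫ arrowSnd V f g)) (by
      apply (eHomEquiv V).injective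
      rw [← eHomEquiv_whiskerLeft, ← eHomEquiv_whiskerRight]
      simp [arrow_condition])
  left_inv h := by ext <;> simp
  right_inv h := by apply arrowHom_ext <;> simp

/-- The `V`-category `C^2` of arrows of `C`; its underlying category is `Arrow C`. -/
noncomputable instance arrowEnriched : EnrichedOrdinaryCategory V (Arrow C) where
  Hom f g := arrowHom V f g
  id f := arrowId V f
  comp f g h := arrowComp V f g h
  id_comp f g := by
    apply arrowHom_ext
    · rw [Category.assoc, Category.assoc, arrowComp_fst, ← tensorHom_id,
        tensorHom_comp_tensorHom_assoc, arrowId_fst, Category.id_comp, aux_id_comp]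
    · rw [Category.assoc, Category.assoc, arrowComp_snd, ← tensorHom_id,
        tensorHom_comp_tensorHom_assoc, arrowId_snd, Category.id_comp, aux_id_comp]
  comp_id f g := by
    apply arrowHom_ext
    · rw [Category.assoc, Category.assoc, arrowComp_fst, ← id_tensorHom,
        tensorHom_comp_tensorHom_assoc, arrowId_fst, Category.id_comp, aux_comp_id]
    · rw [Category.assoc, Category.assoc, arrowComp_snd, ← id_tensorHom,
        tensorHom_comp_tensorHom_assoc, arrowId_snd, Category.id_comp, aux_comp_id]
  assoc f g h k := by
    apply arrowHom_ext
    · rw [Category.assoc, Category.assoc, arrowComp_fst, ← tensorHom_id,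
        tensorHom_comp_tensorHom_assoc, arrowComp_fst, Category.id_comp, aux_assoc,
        Category.assoc, arrowComp_fst, ← id_tensorHom, tensorHom_comp_tensorHom_assoc,
        arrowComp_fst, Category.id_comp]
    · rw [Category.assoc, Category.assoc, arrowComp_snd, ← tensorHom_id,
        tensorHom_comp_tensorHom_assoc, arrowComp_snd, Category.id_comp, aux_assoc,
        Category.assoc, arrowComp_snd, ← id_tensorHom, tensorHom_comp_tensorHom_assoc,
        arrowComp_snd, Category.id_comp]
  homEquiv {f g} := arrowHomEquiv V f g
  homEquiv_id f := arrowElt_id V f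
  homEquiv_comp a b := arrowElt_comp V a b

end Arrow

/-! ### `V`-functors and `V`-natural transformations -/

section Functors

variable (V : Type u₁) [Category.{v₁} V] [MonoidalCategory V]

section Underlying

variable {V}
variable {D : Type u₂} [Category.{v₂} D] [EnrichedOrdinaryCategory V D]
variable {C : Type u₃} [Category.{v₃} C] [EnrichedOrdinaryCategory V C]

/-- The action of a `V`-functor on the morphisms of the underlying categories. -/
def mapHom (F : EnrichedFunctor V D C) {X Y : D} (f : X ⟶ Y) : F.obj X ⟶ F.obj Y :=
  (eHomEquiv V).symm (eHomEquiv V f ≫ F.map X Y)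

@[simp]
lemma eHomEquiv_mapHom (F : EnrichedFunctor V D C) {X Y : D} (f : X ⟶ Y) :
    eHomEquiv V (mapHom F f) = eHomEquiv V f ≫ F.map X Y := by simp [mapHom]

@[simp]
lemma mapHom_id (F : EnrichedFunctor V D C) (X : D) : mapHom F (𝟙 X) = 𝟙 (F.obj X) :=
  (eHomEquiv V).injective (by simp)

@[simp]
lemma mapHom_comp (F : EnrichedFunctor V D C) {X Y Z : D} (f : X ⟶ Y) (g : Y ⟶ Z) :
    mapHom F (f ≫ g) = mapHom F f ≫ mapHom F g :=
  (eHomEquiv V).injective (by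
    simp only [eHomEquiv_mapHom, eHomEquiv_comp, Category.assoc, EnrichedFunctor.map_comp,
      tensorHom_comp_tensorHom_assoc])

/-- The functor of underlying categories of a `V`-functor. -/
@[simps]
def underlying (F : EnrichedFunctor V D C) : D ⥤ C where
  obj X := F.obj X
  map f := mapHom F f
  map_id X := mapHom_id F X
  map_comp f g := mapHom_comp F f g

end Underlying

/-- `V`-naturality of a family `τ d : F d ⟶ G d`: the two maps `D(d, d') ⟶ C(F d, G d')`
agree. -/
def IsVNatural {D : Type u₂} [EnrichedCategory V D] {C : Type u₃} [Category.{v₃} C]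
    [EnrichedOrdinaryCategory V C] (F G : EnrichedFunctor V D C)
    (τ : ∀ d, F.obj d ⟶ G.obj d) : Prop :=
  ∀ d d' : D, F.map d d' ≫ eHomWhiskerLeft V (F.obj d) (τ d') =
    G.map d d' ≫ eHomWhiskerRight V (τ d) (G.obj d')

variable [HasPullbacks V]

section Arrow

variable (C : Type u₃) [Category.{v₃} C] [EnrichedOrdinaryCategory V C]

/-- The domain `V`-functor `C^2 ⟶ C`. -/
noncomputable def domFunctor : EnrichedFunctor V (Arrow C) C where
  obj f := f.left
  map f g := arrowFst V f g
  map_id f := arrowId_fst V f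
  map_comp f g h := arrowComp_fst V f g h

/-- The codomain `V`-functor `C^2 ⟶ C`. -/
noncomputable def codFunctor : EnrichedFunctor V (Arrow C) C where
  obj f := f.right
  map f g := arrowSnd V f g
  map_id f := arrowId_snd V f
  map_comp f g h := arrowComp_snd V f g h

variable {V C}
variable {D : Type u₂} [EnrichedCategory V D]

/-- A `V`-natural transformation `τ : F ⟶ G : D ⟶ C`, as a `V`-functor `D ⟶ C^2`. -/
noncomputable def toArrow (F G : EnrichedFunctor V D C) (τ : ∀ d, F.obj d ⟶ G.obj d)
    (h : IsVNatural V F G τ) : EnrichedFunctor V D (Arrow C) where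
  obj d := Arrow.mk (τ d)
  map d d' := arrowLift V (F.map d d') (G.map d d') (h d d')
  map_id d := by
    apply arrowHom_ext
    · exact ((Category.assoc _ _ _).trans (by rw [arrowLift_fst]; exact F.map_id d)).trans
        (arrowId_fst V (Arrow.mk (τ d))).symm
    · exact ((Category.assoc _ _ _).trans (by rw [arrowLift_snd]; exact G.map_id d)).trans
        (arrowId_snd V (Arrow.mk (τ d))).symm
  map_comp d d' d'' := by
    apply arrowHom_ext
    · refine ((Category.assoc _ _ _).trans (by rw [arrowLift_fst, F.map_comp])).trans
        (((Category.assoc _ _ _).trans ?_).symm)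
      refine (congrArg _ (arrowComp_fst V _ _ _)).trans ?_
      rw [tensorHom_comp_tensorHom_assoc, arrowLift_fst, arrowLift_fst]
      rfl
    · refine ((Category.assoc _ _ _).trans (by rw [arrowLift_snd, G.map_comp])).trans
        (((Category.assoc _ _ _).trans ?_).symm)
      refine (congrArg _ (arrowComp_snd V _ _ _)).trans ?_
      rw [tensorHom_comp_tensorHom_assoc, arrowLift_snd, arrowLift_snd]
      rfl

end Arrow

end Functors

section Representables

open scoped MonoidalClosed

variable {V : Type u₁} [Category.{v₁} V] [MonoidalCategory V] [MonoidalClosed V]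

lemma uncurry_self_comp {A B X Y Z : V} (a : A ⟶ (ihom X).obj Y) (b : B ⟶ (ihom Y).obj Z) :
    MonoidalClosed.uncurry ((a ⊗ₘ b) ≫ MonoidalClosed.comp X Y Z) =
      (α_ X A B).inv ≫ (MonoidalClosed.uncurry a) ▷ B ≫ MonoidalClosed.uncurry b := by
  rw [MonoidalClosed.uncurry_natural_left, MonoidalClosed.comp_eq, MonoidalClosed.uncurry_curry,
    MonoidalClosed.compTranspose_eq, MonoidalClosed.uncurry_eq, MonoidalClosed.uncurry_eq]
  simp only [MonoidalCategory.tensorHom_def, MonoidalCategory.whiskerLeft_comp, comp_whiskerRight,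
    Category.assoc]
  rw [associator_inv_naturality_right_assoc, associator_inv_naturality_middle_assoc,
    whisker_exchange_assoc]
  rfl

variable {C : Type u₃}

/-- The covariant representable `C(A, -) : C ⟶ V`. -/
def covHom [EnrichedCategory V C] (A : C) : EnrichedFunctor V C V where
  obj X := A ⟶[V] X
  map X Y := MonoidalClosed.curry (eComp V A X Y)
  map_id X := by
    apply MonoidalClosed.uncurry_injective
    rw [MonoidalClosed.uncurry_natural_left, MonoidalClosed.uncurry_curry]
    refine Eq.trans ?_ (MonoidalClosed.uncurry_curry _).symm
    rw [← cancel_epi (ρ_ _).inv, e_comp_id, Iso.inv_hom_id]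
  map_comp X Y Z := by
    apply MonoidalClosed.uncurry_injective
    refine Eq.trans ?_ (uncurry_self_comp _ _).symm
    rw [MonoidalClosed.uncurry_natural_left, MonoidalClosed.uncurry_curry,
      MonoidalClosed.uncurry_curry, MonoidalClosed.uncurry_curry, e_assoc]

variable [BraidedCategory V]

lemma contra_aux (V : Type u₁) [Category.{v₁} V] [MonoidalCategory V] [BraidedCategory V]
    [EnrichedCategory V C] (A B D X : C) :
    (A ⟶[V] X) ◁ ((β_ (B ⟶[V] A) (D ⟶[V] B)).hom ≫ eComp V D B A) ≫
        (β_ (A ⟶[V] X) (D ⟶[V] A)).hom ≫ eComp V D A X =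
      (α_ _ _ _).inv ≫ ((β_ (A ⟶[V] X) (B ⟶[V] A)).hom ≫ eComp V B A X) ▷ (D ⟶[V] B) ≫
        (β_ (B ⟶[V] X) (D ⟶[V] B)).hom ≫ eComp V D B X := by
  rw [MonoidalCategory.whiskerLeft_comp, Category.assoc,
    BraidedCategory.braiding_naturality_right_assoc, comp_whiskerRight, Category.assoc,
    BraidedCategory.braiding_naturality_left_assoc, ← e_assoc',
    BraidedCategory.braiding_tensor_right_hom, BraidedCategory.braiding_tensor_left_hom]
  simp only [Category.assoc, Iso.inv_hom_id_assoc]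
  rw [← BraidedCategory.yang_baxter_assoc]

/-- The contravariant representable `C(-, X) : C^op ⟶ V`. -/
def contraHom [EnrichedCategory V C] (X : C) : EnrichedFunctor V Cᵒᵖ V where
  obj A := A.unop ⟶[V] X
  map A B := MonoidalClosed.curry ((β_ _ _).hom ≫ eComp V B.unop A.unop X)
  map_id A := by
    apply MonoidalClosed.uncurry_injective
    rw [MonoidalClosed.uncurry_natural_left, MonoidalClosed.uncurry_curry]
    refine Eq.trans ?_ (MonoidalClosed.uncurry_curry _).symm
    rw [BraidedCategory.braiding_naturality_right_assoc, braiding_tensorUnit_right,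
      Category.assoc]
    erw [e_id_comp]
    exact Category.comp_id _
  map_comp A B C := by
    apply MonoidalClosed.uncurry_injective
    refine Eq.trans ?_ (uncurry_self_comp _ _).symm
    rw [MonoidalClosed.uncurry_natural_left, MonoidalClosed.uncurry_curry,
      MonoidalClosed.uncurry_curry, MonoidalClosed.uncurry_curry]
    exact contra_aux V _ _ _ _

/-- The opposite of a `V`-functor. -/
def opFunctor {D : Type u₂} [EnrichedCategory V D] [EnrichedCategory V C]
    (F : EnrichedFunctor V D C) : EnrichedFunctor V Dᵒᵖ Cᵒᵖ where
  obj d := Opposite.op (F.obj d.unop)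
  map d d' := F.map d'.unop d.unop
  map_id d := F.map_id d.unop
  map_comp d d' d'' := by
    rw [eComp_op_eq, tensorHom_eComp_op_eq, Category.assoc, F.map_comp]
    rfl

end Representables

/-! ### The maps `C(cod g, dom f) ⟶ C^2(g, f)` -/

section Diag

variable (V : Type u₁) [Category.{v₁} V] [MonoidalCategory V] [HasPullbacks V]
variable {C : Type u₂} [Category.{v₂} C] [EnrichedOrdinaryCategory V C]

/-- The morphism `C(cod g, dom f) ⟶ C^2(g, f)`, `k ↦ (k ∘ g, f ∘ k)`. It is the morphism
`C^2(g, (1, f)) : C^2(g, 1_{dom f}) ⟶ C^2(g, f)`, with `C^2(g, 1_X)` written as `C(cod g, X)`. -/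
noncomputable def arrowDiag (g f : Arrow C) : (g.right ⟶[V] f.left) ⟶ arrowHom V g f :=
  arrowLift V (eHomWhiskerRight V g.hom f.left) (eHomWhiskerLeft V g.right f.hom)
    (eHom_whisker_exchange V g.hom f.hom).symm

@[simp]
lemma arrowDiag_fst (g f : Arrow C) :
    arrowDiag V g f ≫ arrowFst V g f = eHomWhiskerRight V g.hom f.left := arrowLift_fst _ _ _ _

@[simp]
lemma arrowDiag_snd (g f : Arrow C) :
    arrowDiag V g f ≫ arrowSnd V g f = eHomWhiskerLeft V g.right f.hom := arrowLift_snd _ _ _ _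

lemma arrowDiag_left (g' g f : Arrow C) :
    arrowSnd V g' g ▷ (g.right ⟶[V] f.left) ≫ eComp V g'.right g.right f.left ≫
        arrowDiag V g' f =
      (arrowHom V g' g) ◁ arrowDiag V g f ≫ arrowComp V g' g f := by
  apply arrowHom_ext
  · simp only [Category.assoc, arrowDiag_fst, arrowComp_fst]
    rw [eComp_eHomWhiskerRight, ← comp_whiskerRight_assoc, ← arrow_condition,
      ← id_tensorHom, tensorHom_comp_tensorHom_assoc, arrowDiag_fst, Category.id_comp,
      ← tensorHom_id]
    have h := eComp_dinatural (V := V) g'.left f.left g.hom (arrowFst V g' g) (𝟙 _)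
    rw [Category.id_comp] at h
    exact h.symm
  · simp only [Category.assoc, arrowDiag_snd, arrowComp_snd]
    rw [eComp_eHomWhiskerLeft, ← id_tensorHom, ← tensorHom_id, ← id_tensorHom,
      tensorHom_comp_tensorHom_assoc, tensorHom_comp_tensorHom_assoc, arrowDiag_snd]
    simp only [Category.id_comp, Category.comp_id]

lemma arrowDiag_right (g f f' : Arrow C) :
    (g.right ⟶[V] f.left) ◁ arrowFst V f f' ≫ eComp V g.right f.left f'.left ≫
        arrowDiag V g f' =
      arrowDiag V g f ▷ (arrowHom V f f') ≫ arrowComp V g f f' := by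
  apply arrowHom_ext
  · simp only [Category.assoc, arrowDiag_fst, arrowComp_fst]
    rw [eComp_eHomWhiskerRight, ← id_tensorHom, ← tensorHom_id, ← tensorHom_id,
      tensorHom_comp_tensorHom_assoc, tensorHom_comp_tensorHom_assoc, arrowDiag_fst]
    simp only [Category.id_comp, Category.comp_id]
  · simp only [Category.assoc, arrowDiag_snd, arrowComp_snd]
    rw [eComp_eHomWhiskerLeft, ← id_tensorHom, ← id_tensorHom, ← tensorHom_id,
      tensorHom_comp_tensorHom_assoc, tensorHom_comp_tensorHom_assoc, arrowDiag_snd,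
      arrow_condition]
    have h := eComp_dinatural (V := V) g.right f'.right f.hom (𝟙 _) (arrowSnd V f f')
    simp only [Category.id_comp] at h ⊢
    exact h

end Diag

section W

open scoped MonoidalClosed

variable {V : Type u₁} [Category.{v₁} V] [MonoidalCategory V] [MonoidalClosed V]

lemma isVNatural_of_uncurry {D : Type u₂} [EnrichedCategory V D]
    (F G : EnrichedFunctor V D V) (τ : ∀ d, F.obj d ⟶ G.obj d)
    (h : ∀ d d', MonoidalClosed.uncurry (F.map d d') ≫ τ d' =
      τ d ▷ _ ≫ MonoidalClosed.uncurry (G.map d d')) : IsVNatural V F G τ := by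
  intro d d'
  rw [MonoidalClosed.enrichedOrdinaryCategorySelf_eHomWhiskerLeft,
    MonoidalClosed.enrichedOrdinaryCategorySelf_eHomWhiskerRight]
  apply MonoidalClosed.uncurry_injective
  refine (MonoidalClosed.uncurry_natural_right _ _).trans ((h d d').trans ?_)
  exact (MonoidalClosed.uncurry_pre_app (A := G.obj d) (B := F.obj d) (X := G.obj d')
    (G.map d d') (τ d)).symm

variable [BraidedCategory V] [HasPullbacks V]
variable (V)
variable {C : Type u₂} [Category.{v₂} C] [EnrichedOrdinaryCategory V C]

lemma braid_aux (V : Type u₁) [Category.{v₁} V] [MonoidalCategory V] [BraidedCategory V]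
    {P Q A B X Y : V} {a : A ⟶ B} {b : P ⟶ Q} {c : B ⊗ P ⟶ X} {d : X ⟶ Y}
    {e : A ⊗ Q ⟶ Y} (h : a ▷ P ≫ c ≫ d = A ◁ b ≫ e) :
    (P ◁ a ≫ (β_ P B).hom ≫ c) ≫ d = b ▷ A ≫ (β_ Q A).hom ≫ e := by
  rw [Category.assoc, Category.assoc, BraidedCategory.braiding_naturality_right_assoc, h,
    BraidedCategory.braiding_naturality_left_assoc]

/-- For a fixed `f`, the `V`-functor `(C^2)^op ⟶ V^2` sending `g` to the arrow
`C(cod g, dom f) ⟶ C^2(g, f)`. -/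
noncomputable def diagContra (f : Arrow C) : EnrichedFunctor V (Arrow C)ᵒᵖ (Arrow V) :=
  toArrow ((opFunctor (codFunctor V C)).comp V (contraHom f.left)) (contraHom f)
    (fun g => arrowDiag V g.unop f) (isVNatural_of_uncurry _ _ _ fun g g' => by
      have h := arrowDiag_left V g'.unop g.unop f
      refine (congrArg (· ≫ arrowDiag V g'.unop f)
        ((MonoidalClosed.uncurry_natural_left _ _).trans
          (congrArg _ (MonoidalClosed.uncurry_curry _)))).trans ?_
      refine Eq.trans ?_ (congrArg _ (MonoidalClosed.uncurry_curry _).symm)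
      exact braid_aux V h)

/-- For a fixed `g`, the `V`-functor `C^2 ⟶ V^2` sending `f` to the arrow
`C(cod g, dom f) ⟶ C^2(g, f)`. -/
noncomputable def diagCov (g : Arrow C) : EnrichedFunctor V (Arrow C) (Arrow V) :=
  toArrow ((domFunctor V C).comp V (covHom g.right)) (covHom g)
    (fun f => arrowDiag V g f) (isVNatural_of_uncurry _ _ _ fun f f' => by
      have h := arrowDiag_right V g f f'
      refine (congrArg (· ≫ arrowDiag V g f')
        ((MonoidalClosed.uncurry_natural_left _ _).trans
          (congrArg _ (MonoidalClosed.uncurry_curry _)))).trans ?_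
      refine Eq.trans ?_ (congrArg _ (MonoidalClosed.uncurry_curry _).symm)
      exact (Category.assoc _ _ _).trans h)

end W

/-! ### Enriched algebraic weak factorisation systems -/

section AWFS

variable (V : Type u₁) [Category.{v₁} V] [MonoidalCategory V] [HasPullbacks V]
variable (C : Type u₂) [Category.{v₂} C] [EnrichedOrdinaryCategory V C]

/-- A `V`-functorial factorisation `f = ρ_f ∘ λ_f` on `C`, through `K f`. -/
structure FunctorialFactorisation where
  /-- The `V`-functor `K : C^2 ⟶ C`. -/
  K : EnrichedFunctor V (Arrow C) C
  /-- The `V`-natural transformation `λ : dom ⟶ K`. -/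
  lam (f : Arrow C) : f.left ⟶ K.obj f
  /-- The `V`-natural transformation `ρ : K ⟶ cod`. -/
  rho (f : Arrow C) : K.obj f ⟶ f.right
  lam_natural : IsVNatural V (domFunctor V C) K lam
  rho_natural : IsVNatural V K (codFunctor V C) rho
  lam_rho (f : Arrow C) : lam f ≫ rho f = f.hom

lemma mapHom_natural {V : Type u₁} [Category.{v₁} V] [MonoidalCategory V]
    {D : Type u₂} [Category.{v₂} D] [EnrichedOrdinaryCategory V D]
    {C : Type u₃} [Category.{v₃} C] [EnrichedOrdinaryCategory V C]
    (F G : EnrichedFunctor V D C) (τ : ∀ d, F.obj d ⟶ G.obj d) (hτ : IsVNatural V F G τ)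
    {d d' : D} (f : d ⟶ d') (g : F.obj d ⟶ F.obj d')
    (hg : eHomEquiv V f ≫ F.map d d' = eHomEquiv V g) :
    τ d ≫ mapHom G f = g ≫ τ d' := by
  apply (eHomEquiv V).injective
  rw [← eHomEquiv_whiskerRight, ← eHomEquiv_whiskerLeft, eHomEquiv_mapHom, Category.assoc,
    ← hτ, ← hg, Category.assoc]

lemma mapHom_natural' {V : Type u₁} [Category.{v₁} V] [MonoidalCategory V]
    {D : Type u₂} [Category.{v₂} D] [EnrichedOrdinaryCategory V D]
    {C : Type u₃} [Category.{v₃} C] [EnrichedOrdinaryCategory V C]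
    (F G : EnrichedFunctor V D C) (τ : ∀ d, F.obj d ⟶ G.obj d) (hτ : IsVNatural V F G τ)
    {d d' : D} (f : d ⟶ d') (g : G.obj d ⟶ G.obj d')
    (hg : eHomEquiv V f ≫ G.map d d' = eHomEquiv V g) :
    mapHom F f ≫ τ d' = τ d ≫ g := by
  apply (eHomEquiv V).injective
  rw [← eHomEquiv_whiskerLeft, ← eHomEquiv_whiskerRight, eHomEquiv_mapHom, Category.assoc,
    hτ, ← hg, Category.assoc]

namespace FunctorialFactorisation

variable {V C} (𝓕 : FunctorialFactorisation V C)

/-- The endo-`V`-functor `f ↦ λ_f` of `C^2`. -/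
noncomputable def L : EnrichedFunctor V (Arrow C) (Arrow C) :=
  toArrow (domFunctor V C) 𝓕.K 𝓕.lam 𝓕.lam_natural

/-- The endo-`V`-functor `f ↦ ρ_f` of `C^2`. -/
noncomputable def R : EnrichedFunctor V (Arrow C) (Arrow C) :=
  toArrow 𝓕.K (codFunctor V C) 𝓕.rho 𝓕.rho_natural

/-- The action of `K` on commutative squares. -/
noncomputable def Kmap {f g : Arrow C} (h : f ⟶ g) : 𝓕.K.obj f ⟶ 𝓕.K.obj g := mapHom 𝓕.K h

lemma lam_Kmap {f g : Arrow C} (h : f ⟶ g) :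
    𝓕.lam f ≫ 𝓕.Kmap h = h.left ≫ 𝓕.lam g :=
  mapHom_natural (domFunctor V C) 𝓕.K 𝓕.lam 𝓕.lam_natural h h.left (arrowElt_fst V h)

lemma Kmap_rho {f g : Arrow C} (h : f ⟶ g) :
    𝓕.rho f ≫ h.right = 𝓕.Kmap h ≫ 𝓕.rho g := by
  have h1 := mapHom_natural' 𝓕.K (codFunctor V C) 𝓕.rho 𝓕.rho_natural h h.right
    (arrowElt_snd V h)
  exact h1.symm

end FunctorialFactorisation

/-- A `V`-enriched algebraic weak factorisation system on `C`. The comultiplication of the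
comonad on `L` has components `(1, σ_f)`, the multiplication of the monad on `R` has components
`(π_f, 1)`; the counit and the unit are `(1, ρ_f)` and `(λ_f, 1)`. -/
structure AWFS extends FunctorialFactorisation V C where
  sigma (f : Arrow C) : K.obj f ⟶ K.obj (Arrow.mk (lam f))
  pi (f : Arrow C) : K.obj (Arrow.mk (rho f)) ⟶ K.obj f
  sigma_natural : IsVNatural V K (toFunctorialFactorisation.L.comp V K) sigma
  pi_natural : IsVNatural V (toFunctorialFactorisation.R.comp V K) K pi
  lam_sigma (f : Arrow C) : lam f ≫ sigma f = lam (Arrow.mk (lam f))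
  pi_rho (f : Arrow C) : pi f ≫ rho f = rho (Arrow.mk (rho f))
  counit_left (f : Arrow C) : sigma f ≫ rho (Arrow.mk (lam f)) = 𝟙 _
  counit_right (f : Arrow C) : sigma f ≫ toFunctorialFactorisation.Kmap
      (Arrow.homMk (f := Arrow.mk (lam f)) (g := f) (𝟙 _) (rho f)
        ((Category.id_comp _).trans (lam_rho f).symm)) = 𝟙 _
  coassoc (f : Arrow C) : sigma f ≫ sigma (Arrow.mk (lam f)) =
    sigma f ≫ toFunctorialFactorisation.Kmap
      (Arrow.homMk (f := Arrow.mk (lam f)) (g := Arrow.mk (lam (Arrow.mk (lam f))))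
        (𝟙 _) (sigma f) ((Category.id_comp _).trans (lam_sigma f).symm))
  unit_left (f : Arrow C) : lam (Arrow.mk (rho f)) ≫ pi f = 𝟙 _
  unit_right (f : Arrow C) : toFunctorialFactorisation.Kmap
      (Arrow.homMk (f := f) (g := Arrow.mk (rho f)) (lam f) (𝟙 _)
        ((lam_rho f).trans (Category.comp_id _).symm)) ≫ pi f = 𝟙 _
  assoc (f : Arrow C) : toFunctorialFactorisation.Kmap
      (Arrow.homMk (f := Arrow.mk (rho (Arrow.mk (rho f)))) (g := Arrow.mk (rho f))
        (pi f) (𝟙 _) ((pi_rho f).trans (Category.comp_id _).symm)) ≫ pi f =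
    pi (Arrow.mk (rho f)) ≫ pi f
  /-- `(σ_f, π_f) : L R f ⟶ R L f` is a mixed distributive law. -/
  distrib (f : Arrow C) : pi f ≫ sigma f = sigma (Arrow.mk (rho f)) ≫
    toFunctorialFactorisation.Kmap
      (Arrow.homMk (f := Arrow.mk (lam (Arrow.mk (rho f))))
        (g := Arrow.mk (rho (Arrow.mk (lam f)))) (sigma f) (pi f)
        ((counit_left f).trans (unit_left f).symm)) ≫ pi (Arrow.mk (lam f))

namespace AWFS

variable {V C} (𝓐 : AWFS V C)

/-- `p` is an algebra structure `(p, 1) : R g ⟶ g` for the monad on `R`. -/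
structure IsAlg (g : Arrow C) (p : 𝓐.K.obj g ⟶ g.left) : Prop where
  comp_hom : p ≫ g.hom = 𝓐.rho g
  unit : 𝓐.lam g ≫ p = 𝟙 _
  assoc : 𝓐.Kmap (Arrow.homMk (f := Arrow.mk (𝓐.rho g)) (g := g) p (𝟙 _)
    (comp_hom.trans (Category.comp_id _).symm)) ≫ p = 𝓐.pi g ≫ p

/-- The structure map of the composite of an algebra `(f, p)` followed by an algebra `(g, q)`. -/
noncomputable def compStr {X Y Z : C} (f : X ⟶ Y) (g : Y ⟶ Z) (k : X ⟶ Z) (hk : f ≫ g = k)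
    (p : 𝓐.K.obj (Arrow.mk f) ⟶ X) (q : 𝓐.K.obj (Arrow.mk g) ⟶ Y)
    (hq : 𝓐.lam (Arrow.mk g) ≫ q = 𝟙 Y) : 𝓐.K.obj (Arrow.mk k) ⟶ X :=
  𝓐.sigma (Arrow.mk k) ≫ 𝓐.Kmap (Arrow.homMk (f := Arrow.mk (𝓐.lam (Arrow.mk k)))
    (g := Arrow.mk f) (𝟙 X)
    (𝓐.Kmap (Arrow.homMk (f := Arrow.mk k) (g := Arrow.mk g) f (𝟙 Z)
      (by simpa using hk)) ≫ q) (by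
      refine (Category.id_comp _).trans (Eq.symm ?_)
      refine (Category.assoc _ _ _).symm.trans ?_
      refine (congrArg (· ≫ q) (𝓐.lam_Kmap _)).trans ?_
      refine (Category.assoc _ _ _).trans ?_
      exact (congrArg (f ≫ ·) hq).trans (Category.comp_id f))) ≫ p

/-- An AWFS is cocontinuous when the functor `K` preserves small colimits. -/
def Cocontinuous : Prop :=
  PreservesColimitsOfSize.{w, w} (underlying 𝓐.K)

end AWFS

end AWFS

/-! ### Inserters -/

section Inserter

variable {V : Type u₁} [Category.{v₁} V] [MonoidalCategory V]
variable {D : Type u₂} [Category.{v₂} D] [EnrichedOrdinaryCategory V D]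
variable {E : Type u₃} [Category.{v₃} E] [EnrichedOrdinaryCategory V E]

/-- Objects of the inserter of a family of pairs of `V`-functors `F i, G i : D ⟶ E`: an object
`x` of `D` with a morphism `F i x ⟶ G i x` for each `i`. -/
structure Inserter {I : Type w} (F G : I → EnrichedFunctor V D E) where
  obj : D
  str (i : I) : (F i).obj obj ⟶ (G i).obj obj

namespace Inserter

variable {I : Type w} {F G : I → EnrichedFunctor V D E}

/-- Morphisms of the inserter: morphisms of `D` that commute with the structures. -/
@[ext]
structure Hom (x y : Inserter F G) where
  hom : x.obj ⟶ y.obj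
  comm (i : I) : mapHom (F i) hom ≫ y.str i = x.str i ≫ mapHom (G i) hom

instance : Category (Inserter F G) where
  Hom := Hom
  id x := ⟨𝟙 _, fun i => by
    rw [mapHom_id, mapHom_id, Category.id_comp, Category.comp_id]⟩
  comp f g := ⟨f.hom ≫ g.hom, fun i => by
    rw [mapHom_comp, mapHom_comp, Category.assoc, g.comm, ← Category.assoc, f.comm, Category.assoc]⟩
  id_comp f := Hom.ext (Category.id_comp _)
  comp_id f := Hom.ext (Category.comp_id _)
  assoc f g h := Hom.ext (Category.assoc _ _ _)

/-- The forgetful functor from the inserter. -/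
@[simps]
def forget (F G : I → EnrichedFunctor V D E) : Inserter F G ⥤ D where
  obj x := x.obj
  map f := f.hom

/-- The two maps `D(x, y) ⟶ E(F i x, G i y)` agree along `a`. -/
def Commutes {x y : Inserter F G} {A : V} (a : A ⟶ (x.obj ⟶[V] y.obj)) : Prop :=
  ∀ i, a ≫ (F i).map _ _ ≫ eHomWhiskerLeft V _ (y.str i) =
    a ≫ (G i).map _ _ ≫ eHomWhiskerRight V (x.str i) _

lemma commutes_id (x : Inserter F G) : Commutes (x := x) (y := x) (eId V x.obj) := fun i => by
  rw [EnrichedFunctor.map_id_assoc, EnrichedFunctor.map_id_assoc, ← eHomEquiv_id, ← eHomEquiv_id,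
    eHomEquiv_whiskerLeft, eHomEquiv_whiskerRight, Category.id_comp, Category.comp_id]

lemma commutes_comp {x y z : Inserter F G} {A B : V} {a : A ⟶ (x.obj ⟶[V] y.obj)}
    {b : B ⟶ (y.obj ⟶[V] z.obj)} (ha : Commutes (x := x) (y := y) a)
    (hb : Commutes (x := y) (y := z) b) :
    Commutes (x := x) (y := z) ((a ⊗ₘ b) ≫ eComp V _ _ _) := fun i => by
  have e1 : ((a ≫ (F i).map _ _) ⊗ₘ (b ≫ (F i).map _ _)) ≫ _ ◁ eHomWhiskerLeft V _ (z.str i) =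
      (a ≫ (F i).map _ _) ⊗ₘ ((b ≫ (G i).map _ _) ≫ eHomWhiskerRight V (y.str i) _) := by
    rw [Category.assoc b, ← hb i, ← id_tensorHom, tensorHom_comp_tensorHom, Category.comp_id,
      Category.assoc]
  have e2 : ((a ≫ (G i).map _ _) ⊗ₘ (b ≫ (G i).map _ _)) ≫ eHomWhiskerRight V (x.str i) _ ▷ _ =
      ((a ≫ (F i).map _ _) ≫ eHomWhiskerLeft V _ (y.str i)) ⊗ₘ (b ≫ (G i).map _ _) := by
    rw [Category.assoc a, ha i, ← tensorHom_id, tensorHom_comp_tensorHom, Category.comp_id,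
      Category.assoc]
  rw [Category.assoc, EnrichedFunctor.map_comp_assoc, tensorHom_comp_tensorHom_assoc,
    eComp_eHomWhiskerLeft, reassoc_of% e1, ← Category.assoc b, eComp_dinatural, Category.assoc (a ⊗ₘ b),
    EnrichedFunctor.map_comp_assoc,
    tensorHom_comp_tensorHom_assoc, eComp_eHomWhiskerRight, reassoc_of% e2, Category.assoc a]

lemma commutes_elt_iff {x y : Inserter F G} (f : x.obj ⟶ y.obj) :
    Commutes (x := x) (y := y) (eHomEquiv V f) ↔
      ∀ i, mapHom (F i) f ≫ y.str i = x.str i ≫ mapHom (G i) f := by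
  refine forall_congr' fun i => ?_
  rw [← Category.assoc, ← Category.assoc, ← eHomEquiv_mapHom, ← eHomEquiv_mapHom,
    eHomEquiv_whiskerLeft, eHomEquiv_whiskerRight, (eHomEquiv V).injective.eq_iff]

variable [HasEqualizers V] [HasProductsOfShape I V]

/-- The hom-object of the inserter: the equaliser of
`D(x, y) ⇉ ∏ i, E(F i x, G i y)`. -/
noncomputable def homObj (x y : Inserter F G) : V :=
  equalizer
    (Pi.lift fun i => (F i).map x.obj y.obj ≫ eHomWhiskerLeft V ((F i).obj x.obj) (y.str i))
    (Pi.lift fun i => (G i).map x.obj y.obj ≫ eHomWhiskerRight V (x.str i) ((G i).obj y.obj))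

/-- The inclusion of the hom-object of the inserter in that of `D`. -/
noncomputable def homIncl (x y : Inserter F G) : homObj x y ⟶ (x.obj ⟶[V] y.obj) :=
  equalizer.ι _ _

lemma commutes_homIncl (x y : Inserter F G) : Commutes (x := x) (y := y) (homIncl x y) :=
  fun i => by
    have h := congrArg (· ≫ Pi.π _ i) (equalizer.condition
      (Pi.lift fun i => (F i).map x.obj y.obj ≫ eHomWhiskerLeft V ((F i).obj x.obj) (y.str i))
      (Pi.lift fun i => (G i).map x.obj y.obj ≫
        eHomWhiskerRight V (x.str i) ((G i).obj y.obj)))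
    simp only [Category.assoc, Pi.lift_π] at h
    exact h

/-- The universal property of the hom-object of the inserter. -/
noncomputable def homLift {x y : Inserter F G} {A : V} (a : A ⟶ (x.obj ⟶[V] y.obj))
    (ha : Commutes (x := x) (y := y) a) : A ⟶ homObj x y :=
  equalizer.lift a (Pi.hom_ext _ _ fun i => by
    simpa only [Category.assoc, Pi.lift_π] using ha i)

@[simp]
lemma homLift_incl {x y : Inserter F G} {A : V} (a : A ⟶ (x.obj ⟶[V] y.obj))
    (ha : Commutes (x := x) (y := y) a) : homLift a ha ≫ homIncl x y = a :=
  equalizer.lift_ι _ _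

lemma homObj_ext {x y : Inserter F G} {A : V} {a b : A ⟶ homObj x y}
    (h : a ≫ homIncl x y = b ≫ homIncl x y) : a = b := equalizer.hom_ext h

/-- The composition of the inserter. -/
noncomputable def homComp (x y z : Inserter F G) : homObj x y ⊗ homObj y z ⟶ homObj x z :=
  homLift ((homIncl x y ⊗ₘ homIncl y z) ≫ eComp V _ _ _)
    (commutes_comp (commutes_homIncl x y) (commutes_homIncl y z))

@[simp]
lemma homComp_incl (x y z : Inserter F G) :
    homComp x y z ≫ homIncl x z = (homIncl x y ⊗ₘ homIncl y z) ≫ eComp V _ _ _ :=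
  homLift_incl _ _

/-- Morphisms of the inserter are the elements of its hom-objects. -/
noncomputable def homEquiv (x y : Inserter F G) : (x ⟶ y) ≃ (𝟙_ V ⟶ homObj x y) where
  toFun f := homLift (eHomEquiv V f.hom) ((commutes_elt_iff _).2 f.comm)
  invFun a := ⟨(eHomEquiv V).symm (a ≫ homIncl x y), (commutes_elt_iff _).1 (by
    rw [Equiv.apply_symm_apply]
    exact fun i => by rw [Category.assoc, commutes_homIncl x y i, Category.assoc])⟩
  left_inv f := Hom.ext (by simp)
  right_inv a := homObj_ext (by simp)

lemma homEquiv_incl {x y : Inserter F G} (f : x ⟶ y) :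
    homEquiv x y f ≫ homIncl x y = eHomEquiv V f.hom :=
  homLift_incl (eHomEquiv V f.hom) ((commutes_elt_iff f.hom).2 f.comm)

/-- The inserter as a `V`-category. -/
noncomputable instance enriched : EnrichedOrdinaryCategory V (Inserter F G) where
  Hom := homObj
  id x := homLift (eId V x.obj) (commutes_id x)
  comp := homComp
  id_comp x y := by
    apply homObj_ext
    rw [Category.assoc, Category.assoc, homComp_incl, ← tensorHom_id,
      tensorHom_comp_tensorHom_assoc, homLift_incl, Category.id_comp, aux_id_comp]
  comp_id x y := by
    apply homObj_ext
    rw [Category.assoc, Category.assoc, homComp_incl, ← id_tensorHom,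
      tensorHom_comp_tensorHom_assoc, homLift_incl, Category.id_comp, aux_comp_id]
  assoc w x y z := by
    apply homObj_ext
    rw [Category.assoc, Category.assoc, homComp_incl, ← tensorHom_id,
      tensorHom_comp_tensorHom_assoc, homComp_incl, Category.id_comp, aux_assoc,
      Category.assoc, homComp_incl, ← id_tensorHom, tensorHom_comp_tensorHom_assoc,
      homComp_incl, Category.id_comp]
  homEquiv {x y} := homEquiv x y
  homEquiv_id x := by
    apply homObj_ext
    rw [homEquiv_incl]
    exact (eHomEquiv_id V x.obj).trans (homLift_incl (eId V x.obj) (commutes_id x)).symm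
  homEquiv_comp {x y z} f g := by
    apply homObj_ext
    rw [homEquiv_incl]
    refine (eHomEquiv_comp V f.hom g.hom).trans ?_
    rw [Category.assoc, Category.assoc]
    refine congrArg _ (Eq.symm ((congrArg _ (homComp_incl x y z)).trans ?_))
    rw [tensorHom_comp_tensorHom_assoc, homEquiv_incl, homEquiv_incl]

end Inserter

end Inserter

/-! ### Internal categories in `V`-categories -/

section Internal

variable (V : Type u₁) [Category.{v₁} V] [MonoidalCategory V]

/-- The total type of a family of types of arrows. -/
structure TotalArr {O : Type w} (Ver : O → O → Type w) where
  src : O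
  tgt : O
  arr : Ver src tgt

/-- A graph internal to small `V`-categories: a `V`-category of objects, a `V`-category whose
objects are the (vertical) arrows, and source and target `V`-functors. The arrows are given by
the family of the types of arrows with prescribed source and target. -/
structure InternalGraph where
  Obj : Type w
  Ver : Obj → Obj → Type w
  [objCat : EnrichedCategory V Obj]
  [arrCat : EnrichedCategory V (TotalArr Ver)]
  /-- The source `V`-functor on hom-objects. -/
  srcMap (x y : TotalArr Ver) : (x ⟶[V] y) ⟶ (x.src ⟶[V] y.src)
  srcMap_id (x : TotalArr Ver) : eId V x ≫ srcMap x x = eId V x.src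
  srcMap_comp (x y z : TotalArr Ver) : eComp V x y z ≫ srcMap x z =
    (srcMap x y ⊗ₘ srcMap y z) ≫ eComp V x.src y.src z.src
  /-- The target `V`-functor on hom-objects. -/
  tgtMap (x y : TotalArr Ver) : (x ⟶[V] y) ⟶ (x.tgt ⟶[V] y.tgt)
  tgtMap_id (x : TotalArr Ver) : eId V x ≫ tgtMap x x = eId V x.tgt
  tgtMap_comp (x y z : TotalArr Ver) : eComp V x y z ≫ tgtMap x z =
    (tgtMap x y ⊗ₘ tgtMap y z) ≫ eComp V x.tgt y.tgt z.tgt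

attribute [instance] InternalGraph.objCat InternalGraph.arrCat

namespace InternalGraph

variable {V}
variable (J : InternalGraph.{v₁, u₁, w} V)

/-- The objects of the `V`-category of arrows. -/
abbrev Arr : Type w := TotalArr J.Ver

/-- An arrow `a ⟶ b`, as an object of the `V`-category of arrows. -/
abbrev ar {a b : J.Obj} (i : J.Ver a b) : J.Arr := ⟨a, b, i⟩

/-- The source `V`-functor. -/
def srcFunctor : EnrichedFunctor V J.Arr J.Obj where
  obj x := x.src
  map := J.srcMap
  map_id := J.srcMap_id
  map_comp := J.srcMap_comp

/-- The target `V`-functor. -/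
def tgtFunctor : EnrichedFunctor V J.Arr J.Obj where
  obj x := x.tgt
  map := J.tgtMap
  map_id := J.tgtMap_id
  map_comp := J.tgtMap_comp

variable [HasPullbacks V]

section Pair

variable {a b d a' b' d' a'' b'' d'' : J.Obj}

/-- The hom-object from `(i, j)` to `(i', j')` in the `V`-category of composable pairs, which is
the pullback of the target and the source `V`-functors. -/
noncomputable def pairHom (i : J.Ver a b) (j : J.Ver b d) (i' : J.Ver a' b') (j' : J.Ver b' d') :
    V :=
  pullback (J.tgtMap (J.ar i) (J.ar i')) (J.srcMap (J.ar j) (J.ar j'))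

/-- The first projection from the `V`-category of composable pairs. -/
noncomputable def pairFst (i : J.Ver a b) (j : J.Ver b d) (i' : J.Ver a' b') (j' : J.Ver b' d') :
    J.pairHom i j i' j' ⟶ (J.ar i ⟶[V] J.ar i') := pullback.fst _ _

/-- The second projection from the `V`-category of composable pairs. -/
noncomputable def pairSnd (i : J.Ver a b) (j : J.Ver b d) (i' : J.Ver a' b') (j' : J.Ver b' d') :
    J.pairHom i j i' j' ⟶ (J.ar j ⟶[V] J.ar j') := pullback.snd _ _

lemma pair_condition (i : J.Ver a b) (j : J.Ver b d) (i' : J.Ver a' b') (j' : J.Ver b' d') :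
    J.pairFst i j i' j' ≫ J.tgtMap (J.ar i) (J.ar i') =
      J.pairSnd i j i' j' ≫ J.srcMap (J.ar j) (J.ar j') := pullback.condition

/-- The universal property of the hom-objects of the `V`-category of composable pairs. -/
noncomputable def pairLift {i : J.Ver a b} {j : J.Ver b d} {i' : J.Ver a' b'} {j' : J.Ver b' d'}
    {T : V} (s : T ⟶ (J.ar i ⟶[V] J.ar i')) (t : T ⟶ (J.ar j ⟶[V] J.ar j'))
    (h : s ≫ J.tgtMap (J.ar i) (J.ar i') = t ≫ J.srcMap (J.ar j) (J.ar j')) :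
    T ⟶ J.pairHom i j i' j' := pullback.lift s t h

/-- The identities of the `V`-category of composable pairs. -/
noncomputable def pairId (i : J.Ver a b) (j : J.Ver b d) : 𝟙_ V ⟶ J.pairHom i j i j :=
  J.pairLift (eId V (J.ar i)) (eId V (J.ar j))
    ((J.tgtMap_id (J.ar i)).trans (J.srcMap_id (J.ar j)).symm)

/-- The composition of the `V`-category of composable pairs. -/
noncomputable def pairComp (i : J.Ver a b) (j : J.Ver b d) (i' : J.Ver a' b') (j' : J.Ver b' d')
    (i'' : J.Ver a'' b'') (j'' : J.Ver b'' d'') :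
    J.pairHom i j i' j' ⊗ J.pairHom i' j' i'' j'' ⟶ J.pairHom i j i'' j'' :=
  J.pairLift
    ((J.pairFst i j i' j' ⊗ₘ J.pairFst i' j' i'' j'') ≫ eComp V (J.ar i) (J.ar i') (J.ar i''))
    ((J.pairSnd i j i' j' ⊗ₘ J.pairSnd i' j' i'' j'') ≫ eComp V (J.ar j) (J.ar j') (J.ar j''))
    (by
      rw [Category.assoc, J.tgtMap_comp, tensorHom_comp_tensorHom_assoc, pair_condition,
        pair_condition, Category.assoc, J.srcMap_comp, tensorHom_comp_tensorHom_assoc])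

end Pair

end InternalGraph

variable [HasPullbacks V]

/-- A small category internal to `V`-categories: an internal graph with identities and
composition, given by `V`-functors over the `V`-category of objects, that satisfy the unit and
associativity laws, both on objects and on hom-objects. -/
structure InternalCat extends InternalGraph.{v₁, u₁, w} V where
  vid (a : Obj) : Ver a a
  vcomp {a b d : Obj} (i : Ver a b) (j : Ver b d) : Ver a d
  vid_vcomp {a b : Obj} (i : Ver a b) : vcomp (vid a) i = i
  vcomp_vid {a b : Obj} (i : Ver a b) : vcomp i (vid b) = i
  vcomp_assoc {a b d e : Obj} (i : Ver a b) (j : Ver b d) (k : Ver d e) :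
    vcomp (vcomp i j) k = vcomp i (vcomp j k)
  /-- The identity `V`-functor on hom-objects. -/
  vidMap (a a' : Obj) : (a ⟶[V] a') ⟶ (toInternalGraph.ar (vid a) ⟶[V] toInternalGraph.ar (vid a'))
  vidMap_id (a : Obj) : eId V a ≫ vidMap a a = eId V (toInternalGraph.ar (vid a))
  vidMap_comp (a a' a'' : Obj) : eComp V a a' a'' ≫ vidMap a a'' =
    (vidMap a a' ⊗ₘ vidMap a' a'') ≫ eComp V _ _ _
  vidMap_src (a a' : Obj) : vidMap a a' ≫ srcMap _ _ = 𝟙 (a ⟶[V] a')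
  vidMap_tgt (a a' : Obj) : vidMap a a' ≫ tgtMap _ _ = 𝟙 (a ⟶[V] a')
  /-- The composition `V`-functor on hom-objects. -/
  vcompMap {a b d a' b' d' : Obj} (i : Ver a b) (j : Ver b d) (i' : Ver a' b') (j' : Ver b' d') :
    toInternalGraph.pairHom i j i' j' ⟶
      (toInternalGraph.ar (vcomp i j) ⟶[V] toInternalGraph.ar (vcomp i' j'))
  vcompMap_id {a b d : Obj} (i : Ver a b) (j : Ver b d) :
    toInternalGraph.pairId i j ≫ vcompMap i j i j = eId V (toInternalGraph.ar (vcomp i j))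
  vcompMap_comp {a b d a' b' d' a'' b'' d'' : Obj} (i : Ver a b) (j : Ver b d)
    (i' : Ver a' b') (j' : Ver b' d') (i'' : Ver a'' b'') (j'' : Ver b'' d'') :
    toInternalGraph.pairComp i j i' j' i'' j'' ≫ vcompMap i j i'' j'' =
      (vcompMap i j i' j' ⊗ₘ vcompMap i' j' i'' j'') ≫ eComp V _ _ _
  vcompMap_src {a b d a' b' d' : Obj} (i : Ver a b) (j : Ver b d) (i' : Ver a' b')
    (j' : Ver b' d') : vcompMap i j i' j' ≫ srcMap _ _ =
      toInternalGraph.pairFst i j i' j' ≫ srcMap _ _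
  vcompMap_tgt {a b d a' b' d' : Obj} (i : Ver a b) (j : Ver b d) (i' : Ver a' b')
    (j' : Ver b' d') : vcompMap i j i' j' ≫ tgtMap _ _ =
      toInternalGraph.pairSnd i j i' j' ≫ tgtMap _ _
  vidMap_vcompMap {a b a' b' : Obj} (i : Ver a b) (i' : Ver a' b') :
    toInternalGraph.pairLift (srcMap (toInternalGraph.ar i) (toInternalGraph.ar i') ≫ vidMap a a')
        (𝟙 _) (by rw [Category.assoc, vidMap_tgt, Category.comp_id, Category.id_comp]) ≫
      vcompMap (vid a) i (vid a') i' = eqToHom (by rw [vid_vcomp, vid_vcomp])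
  vcompMap_vidMap {a b a' b' : Obj} (i : Ver a b) (i' : Ver a' b') :
    toInternalGraph.pairLift (𝟙 _)
        (tgtMap (toInternalGraph.ar i) (toInternalGraph.ar i') ≫ vidMap b b')
        (by rw [Category.assoc, vidMap_src, Category.comp_id, Category.id_comp]) ≫
      vcompMap i (vid b) i' (vid b') = eqToHom (by rw [vcomp_vid, vcomp_vid])
  vcompMap_assoc {a b d e a' b' d' e' : Obj} (i : Ver a b) (j : Ver b d) (k : Ver d e)
    (i' : Ver a' b') (j' : Ver b' d') (k' : Ver d' e') {T : V}
    (r : T ⟶ (toInternalGraph.ar i ⟶[V] toInternalGraph.ar i'))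
    (s : T ⟶ (toInternalGraph.ar j ⟶[V] toInternalGraph.ar j'))
    (t : T ⟶ (toInternalGraph.ar k ⟶[V] toInternalGraph.ar k'))
    (hrs : r ≫ tgtMap _ _ = s ≫ srcMap _ _) (hst : s ≫ tgtMap _ _ = t ≫ srcMap _ _) :
    toInternalGraph.pairLift (toInternalGraph.pairLift r s hrs ≫ vcompMap i j i' j') t
        (by
          rw [Category.assoc, vcompMap_tgt, ← hst, ← Category.assoc]
          exact congrArg (· ≫ _) (pullback.lift_snd _ _ _)) ≫
      vcompMap (vcomp i j) k (vcomp i' j') k' ≫ eqToHom (by rw [vcomp_assoc, vcomp_assoc]) =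
    toInternalGraph.pairLift r (toInternalGraph.pairLift s t hst ≫ vcompMap j k j' k')
        (by
          rw [Category.assoc, vcompMap_src, hrs, ← Category.assoc]
          exact congrArg (· ≫ _) (pullback.lift_fst _ _ _).symm) ≫
      vcompMap i (vcomp j k) i' (vcomp j' k')

variable {V}

/-- An internal functor from `J` to the internal category of squares of `C`. Its `V`-functor on
arrows sends a vertical arrow to `arrMap i`; on hom-objects it is determined by `srcMap`,
`tgtMap` and `objFunctor`. -/
structure InternalCat.ToSq (J : InternalCat.{v₁, u₁, w} V) (C : Type u₂) [Category.{v₂} C]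
    [EnrichedOrdinaryCategory V C] where
  /-- The `V`-functor on objects. -/
  objFunctor : EnrichedFunctor V J.Obj C
  /-- The morphism of `C` that is the value at a vertical arrow. -/
  arrMap {a b : J.Obj} (i : J.Ver a b) : objFunctor.obj a ⟶ objFunctor.obj b
  natural : IsVNatural V (J.srcFunctor.comp V objFunctor) (J.tgtFunctor.comp V objFunctor)
    fun x => arrMap x.arr
  arrMap_vid (a : J.Obj) : arrMap (J.vid a) = 𝟙 _
  arrMap_vcomp {a b d : J.Obj} (i : J.Ver a b) (j : J.Ver b d) :
    arrMap (J.vcomp i j) = arrMap i ≫ arrMap j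

namespace InternalCat.ToSq

variable {J : InternalCat.{v₁, u₁, w} V} {C : Type u₂} [Category.{v₂} C]
    [EnrichedOrdinaryCategory V C] (U : J.ToSq C)

/-- The `V`-functor `J_1 ⟶ C^2` of an internal functor to squares. -/
noncomputable def arrFunctor : EnrichedFunctor V J.Arr (Arrow C) :=
  toArrow (J.srcFunctor.comp V U.objFunctor) (J.tgtFunctor.comp V U.objFunctor)
    (fun x => U.arrMap x.arr) U.natural

/-- The value of `U` at a vertical arrow, as an object of `C^2`. -/
abbrev ar {a b : J.Obj} (i : J.Ver a b) : Arrow C := Arrow.mk (U.arrMap i)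

end InternalCat.ToSq

end Internal

/-! ### Structured liftings against an internal category -/

section Pullback

variable (V : Type u₁) [Category.{v₁} V] [MonoidalCategory V] [HasPullbacks V]
variable {C : Type u₂} [Category.{v₂} C] [EnrichedOrdinaryCategory V C]
variable {A B D : C} (g : A ⟶ B) (h : B ⟶ D) (k : A ⟶ D) (hk : g ≫ h = k) (f : Arrow C)

/-- For `k = h ∘ g`, the morphism `C^2(h, f) ⟶ C^2(k, f)`, `(s, t) ↦ (s ∘ g, t)`. -/
noncomputable def arrowPre : arrowHom V (Arrow.mk h) f ⟶ arrowHom V (Arrow.mk k) f :=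
  arrowLift V (arrowFst V (Arrow.mk h) f ≫ eHomWhiskerRight V g f.left)
    (arrowSnd V (Arrow.mk h) f) (by
      subst hk
      have h1 := arrow_condition V (Arrow.mk h) f
      have h2 := eHom_whisker_exchange V g f.hom
      dsimp only [Arrow.mk_left, Arrow.mk_right, Arrow.mk_hom] at h1 ⊢
      rw [Category.assoc, ← h2, reassoc_of% h1, ← eHomWhiskerRight_comp])

/-- For `k = h ∘ g`, the morphism `C^2(k, f) ⟶ C^2(g, f)`, `(s, t) ↦ (s, t ∘ h)`. -/
noncomputable def arrowSub : arrowHom V (Arrow.mk k) f ⟶ arrowHom V (Arrow.mk g) f :=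
  arrowLift V (arrowFst V (Arrow.mk k) f)
    (arrowSnd V (Arrow.mk k) f ≫ eHomWhiskerRight V h f.right) (by
      subst hk
      have h1 := arrow_condition V (Arrow.mk (g ≫ h)) f
      dsimp only [Arrow.mk_left, Arrow.mk_right, Arrow.mk_hom] at h1 ⊢
      rw [Category.assoc, ← eHomWhiskerRight_comp, h1])

lemma arrowPre_sub : arrowPre V g h k hk f ≫ arrowSub V g h k hk f =
    arrowFst V (Arrow.mk h) f ≫ arrowDiag V (Arrow.mk g) f := by
  apply arrowHom_ext
  · rw [Category.assoc, arrowSub, arrowLift_fst, arrowPre, arrowLift_fst, Category.assoc,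
      arrowDiag_fst]
    rfl
  · rw [Category.assoc, arrowSub, arrowLift_snd, arrowPre, Category.assoc, arrowDiag_snd,
      ← Category.assoc, arrowLift_snd]
    exact (arrow_condition V (Arrow.mk h) f).symm

lemma arrowDiag_pre : arrowDiag V (Arrow.mk h) f ≫ arrowPre V g h k hk f =
    arrowDiag V (Arrow.mk k) f := by
  subst hk
  apply arrowHom_ext
  · rw [Category.assoc, arrowPre, arrowLift_fst, arrowDiag_fst, ← Category.assoc, arrowDiag_fst]
    exact (eHomWhiskerRight_comp V g h f.left).symm
  · rw [Category.assoc, arrowPre, arrowLift_snd, arrowDiag_snd, arrowDiag_snd]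
    rfl

end Pullback

section Pitchfork

open scoped MonoidalClosed

variable {V : Type u₁} [Category.{v₁} V] [MonoidalCategory V] [MonoidalClosed V]
  [HasPullbacks V]
variable {C : Type u₂} [Category.{v₂} C] [EnrichedOrdinaryCategory V C]

section Pulled

variable (𝓜 : AWFS V V) {A B D : C} (g : A ⟶ B) (h : B ⟶ D) (k : A ⟶ D) (hk : g ≫ h = k)
  (f : Arrow C) (p : 𝓜.K.obj (Arrow.mk (arrowDiag V (Arrow.mk g) f)) ⟶ (B ⟶[V] f.left))

/-- The algebra structure on `C^2(h, f) ⟶ C^2(k, f)`, as the pullback of the algebra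
`C(cod g, dom f) ⟶ C^2(g, f)`. -/
noncomputable def pulledStr (hp : 𝓜.IsAlg (Arrow.mk (arrowDiag V (Arrow.mk g) f)) p) :
    𝓜.K.obj (Arrow.mk (arrowPre V g h k hk f)) ⟶
    arrowHom V (Arrow.mk h) f :=
  arrowLift V
    (𝓜.Kmap (Arrow.homMk (f := Arrow.mk (arrowPre V g h k hk f))
      (g := Arrow.mk (arrowDiag V (Arrow.mk g) f)) (arrowFst V (Arrow.mk h) f)
      (arrowSub V g h k hk f) (arrowPre_sub V g h k hk f).symm) ≫ p)
    (𝓜.rho (Arrow.mk (arrowPre V g h k hk f)) ≫ arrowSnd V (Arrow.mk k) f) (by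
      have h1 : p ≫ eHomWhiskerLeft V B f.hom =
          𝓜.rho (Arrow.mk (arrowDiag V (Arrow.mk g) f)) ≫ arrowSnd V (Arrow.mk g) f := by
        rw [← hp.comp_hom]
        exact ((Category.assoc _ _ _).trans (congrArg _ (arrowDiag_snd V (Arrow.mk g) f))).symm
      refine (Category.assoc _ _ _).trans ((congrArg _ h1).trans ?_)
      refine (Category.assoc _ _ _).symm.trans ?_
      refine (congrArg (· ≫ arrowSnd V (Arrow.mk g) f) (𝓜.Kmap_rho
        (Arrow.homMk (f := Arrow.mk (arrowPre V g h k hk f))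
          (g := Arrow.mk (arrowDiag V (Arrow.mk g) f)) (arrowFst V (Arrow.mk h) f)
          (arrowSub V g h k hk f) (arrowPre_sub V g h k hk f).symm)).symm).trans ?_
      refine (Category.assoc _ _ _).trans (Eq.trans ?_ (Category.assoc _ _ _).symm)
      exact congrArg _ (arrowLift_snd V _ _ _))

lemma lam_pulledStr (hp : 𝓜.IsAlg (Arrow.mk (arrowDiag V (Arrow.mk g) f)) p) :
    𝓜.lam (Arrow.mk (arrowPre V g h k hk f)) ≫
    pulledStr 𝓜 g h k hk f p hp = 𝟙 _ := by
  apply arrowHom_ext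
  · rw [Category.assoc, pulledStr, arrowLift_fst, Category.id_comp]
    refine (Category.assoc _ _ _).symm.trans ?_
    refine (congrArg (· ≫ p) (𝓜.lam_Kmap _)).trans ?_
    refine (Category.assoc _ _ _).trans ?_
    exact (congrArg _ hp.unit).trans (Category.comp_id _)
  · rw [Category.assoc, pulledStr, arrowLift_snd, Category.id_comp]
    refine (Category.assoc _ _ _).symm.trans ?_
    refine (congrArg (· ≫ _) (𝓜.lam_rho _)).trans ?_
    exact arrowLift_snd V _ _ _

end Pulled

variable [BraidedCategory V]
variable {J : InternalCat.{v₁, u₁, w} V} (𝓜 : AWFS V V) (U : J.ToSq C)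

/-- The arrow `C(cod U i, dom f) ⟶ C^2(U i, f)` of `V`. -/
noncomputable abbrev wArr (x : J.Arr) (f : Arrow C) : Arrow V :=
  Arrow.mk (arrowDiag V (U.arrFunctor.obj x) f)

/-- The `V`-functor `f ↦ K(C(cod U i, dom f) ⟶ C^2(U i, f))`. -/
noncomputable def srcStr (x : J.Arr) : EnrichedFunctor V (Arrow C) V :=
  (diagCov V (U.arrFunctor.obj x)).comp V 𝓜.K

/-- The `V`-functor `f ↦ C(cod U i, dom f)`. -/
noncomputable def tgtStr (x : J.Arr) : EnrichedFunctor V (Arrow C) V :=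
  (domFunctor V C).comp V (covHom (U.arrFunctor.obj x).right)

/-- The `V`-functor `i ↦ K(C(cod U i, dom f) ⟶ C^2(U i, f))`, contravariant in `i`. -/
noncomputable def srcPresheaf (f : Arrow C) : EnrichedFunctor V J.Arrᵒᵖ V :=
  ((opFunctor U.arrFunctor).comp V (diagContra V f)).comp V 𝓜.K

/-- The `V`-functor `i ↦ C(cod U i, dom f)`, contravariant in `i`. -/
noncomputable def tgtPresheaf (f : Arrow C) : EnrichedFunctor V J.Arrᵒᵖ V :=
  ((opFunctor U.arrFunctor).comp V (opFunctor (codFunctor V C))).comp V (contraHom f.left)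

/-- The conditions on a family of structures `p_i` on the arrows
`C(cod U i, dom f) ⟶ C^2(U i, f)`: each is an algebra for the monad of the AWFS, the family is
`V`-natural in `i`, and the structure at a vertical composite `j • i` is the composite of the
structure at `j` and of the pullback of the structure at `i`. -/
structure IsPitchfork (x : Inserter (srcStr 𝓜 U) (tgtStr (V := V) U)) : Prop where
  alg (i : J.Arr) : 𝓜.IsAlg (wArr U i x.obj) (x.str i)
  natural : IsVNatural V (srcPresheaf 𝓜 U x.obj) (tgtPresheaf U x.obj) fun i => x.str i.unop
  comp {a b d : J.Obj} (i : J.Ver a b) (j : J.Ver b d) :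
    x.str (J.ar (J.vcomp i j)) = 𝓜.compStr (arrowDiag V (U.ar j) x.obj)
      (arrowPre V (U.arrMap i) (U.arrMap j) (U.arrMap (J.vcomp i j)) (U.arrMap_vcomp i j).symm
        x.obj)
      (arrowDiag V (U.ar (J.vcomp i j)) x.obj) (arrowDiag_pre V _ _ _ _ _) (x.str (J.ar j))
      (pulledStr 𝓜 _ _ _ _ _ (x.str (J.ar i)) (alg (J.ar i)))
      (lam_pulledStr 𝓜 _ _ _ _ _ (x.str (J.ar i)) (alg (J.ar i)))

/-- The category of arrows of `C` equipped with structured liftings against `U`. As a full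
subcategory of an inserter it is a `V`-category: its hom-object from `(f, p)` to `(g, q)` is the
equaliser of `C^2(f, g) ⇉ ∏ i, [K(C(cod U i, dom f) ⟶ C^2(U i, f)), C(cod U i, dom g)]`. -/
abbrev Pitchfork := ObjectProperty.FullSubcategory (IsPitchfork 𝓜 U)

/-- The forgetful functor to `C^2`. -/
noncomputable abbrev pitchforkForget : Pitchfork 𝓜 U ⥤ Arrow C :=
  ObjectProperty.ι (IsPitchfork 𝓜 U) ⋙ Inserter.forget _ _

end Pitchfork

/-! ### Colimits in `V`-categories -/

section Colimits

variable (V : Type u₁) [Category.{v₁} V] [MonoidalCategory V]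

/-- `c` is a colimit in the `V`-enriched sense: each `C(-, Y)` sends it to a limit in `V`. -/
def IsConicalColimit {C : Type u₂} [Category.{v₂} C] [EnrichedOrdinaryCategory V C]
    {𝒟 : Type u₃} [Category.{v₃} 𝒟] {F : 𝒟 ⥤ C} (c : Cocone F) : Prop :=
  ∀ Y : C, Nonempty (IsLimit (((eHomFunctor V C).flip.obj Y).mapCone c.op))

/-- `G` creates the colimit of `D`: each colimit cocone under `D ⋙ G` is the image of a unique
cocone under `D`, and this one is a colimit in the `V`-enriched sense. -/
def CreatesConicalColimit {A : Type u₂} [Category.{v₂} A] [EnrichedOrdinaryCategory V A]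
    {B : Type u₃} [Category.{v₃} B] (G : A ⥤ B) {𝒟 : Type w} [SmallCategory 𝒟] (D : 𝒟 ⥤ A) :
    Prop :=
  ∀ c : Cocone (D ⋙ G), Nonempty (IsColimit c) →
    (∃! c' : Cocone D, G.mapCocone c' = c) ∧
      ∀ c' : Cocone D, G.mapCocone c' = c → IsConicalColimit V c'

/-- `C` is cocomplete as a `V`-category: it has small colimits in the `V`-enriched sense, and
tensors `v ⊗ X`, which are characterised by `C(v ⊗ X, Y) ≅ [v, C(X, Y)]`. -/
structure IsCocomplete [MonoidalClosed V] (C : Type u₂) [Category.{v₂} C]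
    [EnrichedOrdinaryCategory V C] : Prop where
  exists_conicalColimit {𝒟 : Type w} [SmallCategory 𝒟] (F : 𝒟 ⥤ C) :
    ∃ c : Cocone F, IsConicalColimit V c
  exists_tensor (v : V) (X : C) : ∃ (T : C) (η : v ⟶ (X ⟶[V] T)), ∀ Y : C,
    IsIso (MonoidalClosed.curry (η ▷ (T ⟶[V] Y) ≫ eComp V X T Y))

end Colimits

/-! ### Locally ranked categories -/

section Ranked

variable {C : Type u₂} [Category.{v₂} C]

/-- An orthogonal factorisation system: a weak one with unique diagonal fillers. -/
structure IsOFS (E M : MorphismProperty C) : Prop where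
  isWFS : MorphismProperty.IsWeakFactorizationSystem E M
  unique_lift {A B X Y : C} {f : A ⟶ X} {i : A ⟶ B} {p : X ⟶ Y} {g : B ⟶ Y}
    (sq : CommSq f i p g) : E i → M p → Subsingleton sq.LiftStruct

/-- `A` has rank at most `κ` with respect to `M`: `C(A, -)` preserves the colimits of the small
`κ`-filtered diagrams that have a cocone with components in `M`. -/
def HasRankLE (M : MorphismProperty C) (A : C) (κ : Cardinal.{w}) [Fact κ.IsRegular] : Prop :=
  ∀ (𝒟 : Type w) [SmallCategory 𝒟] [IsCardinalFiltered 𝒟 κ] (X : 𝒟 ⥤ C) (m : Cocone X),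
    (∀ d, M (m.ι.app d)) → PreservesColimit X (coyoneda.obj (Opposite.op A))

/-- `C` is locally ranked with respect to the proper orthogonal factorisation system `(E, M)`:
it is cocomplete, it has only a small set of `E`-quotients of each object, and each object has a
rank. -/
structure IsLocallyRanked (E M : MorphismProperty C) : Prop where
  hasColimits : HasColimitsOfSize.{w, w} C
  isOFS : IsOFS E M
  epi {X Y : C} (e : X ⟶ Y) : E e → Epi e
  mono {X Y : C} (m : X ⟶ Y) : M m → Mono m
  cowellpowered (X : C) : ∃ (I : Type w) (Q : I → C) (q : ∀ i, X ⟶ Q i), (∀ i, E (q i)) ∧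
    ∀ (Y : C) (e : X ⟶ Y), E e → ∃ (i : I) (s : Q i ≅ Y), q i ≫ s.hom = e
  exists_rank (A : C) : ∃ (κ : Cardinal.{w}) (_ : Fact κ.IsRegular), HasRankLE M A κ

end Ranked

/-! ### Bases of enrichment -/

section Base

/-- A full sub-2-category of `Cat` suitable as a base of enrichment: it is closed under limits
and exponentials in `Cat`, it has colimits, and it contains the arrow category. -/
class IsBase (P : ObjectProperty Cat.{w, w}) : Prop where
  closedUnderLimits (I : Type w) [SmallCategory I] : P.IsClosedUnderLimitsOfShape I
  prop_exponential (X Y : Cat.{w, w}) : P X → P Y → P ((ihom X).obj Y)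
  hasColimits : HasColimitsOfSize.{w, w} P.FullSubcategory
  prop_two : P (Cat.of (ULift.{w} (Fin 2)))

variable (P : ObjectProperty Cat.{w, w}) [IsBase P]

instance isBase_hasLimits : HasLimits P.FullSubcategory := by
  refine ⟨fun I _ => ?_⟩
  have := IsBase.closedUnderLimits (P := P) I
  infer_instance

instance isBase_isMonoidal : P.IsMonoidal where
  prop_unit := by
    have := IsBase.closedUnderLimits (P := P) (Discrete PEmpty.{w + 1})
    have : P.IsClosedUnderLimitsOfShape (Discrete PEmpty.{1}) :=
      ObjectProperty.IsClosedUnderLimitsOfShape.of_equivalence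
        (Discrete.equivalence (Equiv.equivOfIsEmpty _ _) : Discrete PEmpty.{w + 1} ≌ _)
    exact P.prop_of_isLimit (CartesianMonoidalCategory.isTerminalTensorUnit (C := Cat.{w, w}))
      (fun j => j.as.elim)
  prop_tensor X Y hX hY := by
    have := IsBase.closedUnderLimits (P := P) (Discrete (ULift.{w} WalkingPair))
    have : P.IsClosedUnderLimitsOfShape (Discrete WalkingPair) :=
      ObjectProperty.IsClosedUnderLimitsOfShape.of_equivalence
        (Discrete.equivalence Equiv.ulift : Discrete (ULift.{w} WalkingPair) ≌ _)
    refine P.prop_of_isLimit (CartesianMonoidalCategory.tensorProductIsBinaryProduct X Y) ?_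
    rintro ⟨_ | _⟩
    · exact hX
    · exact hY

instance isBase_isMonoidalClosed : P.IsMonoidalClosed where
  prop_ihom := IsBase.prop_exponential

end Base

end EnrichedAWFS

open EnrichedAWFS
open scoped MonoidalClosed

universe u w

/-! Write $[n]$ for the category $0\to\cdots\to n$. A small category is known by its chains of
length at most two: the 2-truncated nerve is fully faithful, so a cocone in the base $\mathcal V$ is
a colimit as soon as $\mathcal V([n],-)$ sends it to a colimit of sets for $n=0,1,2$
(`nonempty_isColimit_of_ordBase`). Since $\mathcal V([n],\mathcal C(A,X))\cong\mathcal C([n]\otimes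
A,X)$, the $\mathcal V$-valued functor $\mathcal C(A,-)$ preserves each colimit that the ordinary
representables at the three tensors $[n]\otimes A$ preserve. The arrows $i$ form a small set, so a
single $\kappa$ bounds the ranks of all $[n]\otimes\mathrm{dom}\,Ui$ and
$[n]\otimes\mathrm{cod}\,Ui$.

For such $\kappa$, let $c$ be a colimit in $\mathcal C^{\mathbf 2}$ of the underlying diagram. It is
computed componentwise, and $\mathcal C(\mathrm{dom}\,Ui,-)$ and $\mathcal C(\mathrm{cod}\,Ui,-)$
preserve its components. So does $\mathcal C^{\mathbf 2}(Ui,-)$, a pullback of these, because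
filtered colimits of sets commute with pullbacks (`nonempty_isColimit_arrowHom`). Thus $W_i$ sends
$c$ to a colimit in $\mathcal V^{\mathbf 2}$. By cocontinuity $K W_i$ sends it to a colimit too, and
so does $K\rho_{W_i}$, since $\rho_f$ has domain $Kf$ and codomain $\mathrm{cod} f$.

The universal property of $K W_i(c)$ forces a unique structure $p_i$ on the vertex of $c$. Every law
that $p_i$ must satisfy equates two maps out of an object on which the legs are jointly epimorphic,
so it is inherited from the diagram (`IsPitchfork.of_jointly_epi`). For the composition law this
uses that composition and pullback of algebras are functorial (`AWFS.Kmap_compStr`,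
`Kmap_pulledStr`). For $\mathcal V$-naturality in $i$ it uses that in a closed category a jointly
epimorphic family is so in the enriched sense (`eHomWhiskerRight_jointly_mono`).

The same enriched joint epimorphicity gives the enriched universal property. The colimit is conical
in $\mathcal C^{\mathbf 2}$ because $\mathcal C$ has conical colimits, and an induced map into
$\mathcal C^{\mathbf 2}(c,g)$ factors through the equaliser that is the hom-object upstairs
(`Inserter.isConicalColimit_fullSubcategory`). -/

namespace EnrichedAWFS

open Opposite

universe v₁ u₁ v₂ u₂ v₃ u₃ v₄ u₄ w'

/-! ### Colimits of categories detected on chains of length at most two. -/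

section Nerve

/-- The category `0 ⟶ 1 ⟶ ⋯ ⟶ n`. -/
abbrev ordCat (n : ℕ) : Cat.{u, u} := Cat.of (ULift.{u} (Fin (n + 1)))

/-- Functors out of `0 ⟶ 1 ⟶ ⋯ ⟶ n` are chains of `n` composable arrows. -/
def ordCatHomEquiv (n : ℕ) (X : Cat.{u, u}) : (ordCat.{u} n ⟶ X) ≃ ComposableArrows X n where
  toFun F := Monotone.functor (f := ULift.up) (fun _ _ h => h) ⋙ F.toFunctor
  invFun F := (Monotone.functor (f := ULift.down) (fun _ _ h => h) ⋙ F).toCatHom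
  left_inv _ := rfl
  right_inv _ := rfl

/-- The `2`-truncated nerve is represented by finite ordinals. -/
def coyonedaOrdCatIso (n : ℕ) (hn : n ≤ 2) : coyoneda.obj (op (ordCat.{u} n)) ≅
    Nerve.nerveFunctor₂.{u, u} ⋙ (evaluation _ _).obj (op ⟨SimplexCategory.mk n, hn⟩) :=
  NatIso.ofComponents (fun X => (ordCatHomEquiv n X).toIso) (fun _ => rfl)

/-- The 2-truncated nerve is fully faithful, hence reflects colimits, and colimits of presheaves are
computed pointwise, at $[0]$, $[1]$ and $[2]$. -/
lemma nonempty_isColimit_of_ordCat {𝒟 : Type*} [Category* 𝒟] {F : 𝒟 ⥤ Cat.{u, u}}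
    (c : Cocone F)
    (h : ∀ n ≤ 2, Nonempty (IsColimit ((coyoneda.obj (op (ordCat.{u} n))).mapCocone c))) :
    Nonempty (IsColimit c) := by
  refine ⟨isColimitOfReflects Nerve.nerveFunctor₂.{u, u}
    (evaluationJointlyReflectsColimits _ fun k => ?_)⟩
  obtain ⟨⟨k, hk⟩⟩ := k
  induction k with | _ n
  exact IsColimit.mapCoconeEquiv (coyonedaOrdCatIso n hk) (h n hk).some

end Nerve

/-! ### The ordinals $[0]$, $[1]$, $[2]$ in a base of enrichment. -/

section Base

variable (P : ObjectProperty Cat.{u, u}) [IsBase P]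

lemma functor_ext_of_preorder {D α : Type*} [Category* D] [Preorder α] {F G : D ⥤ α}
    (h : ∀ x, F.obj x = G.obj x) : F = G :=
  CategoryTheory.Functor.ext h fun _ _ _ => Subsingleton.elim _ _

/-- A retract of $Y$ is the equaliser of the identity and the idempotent on $Y$, and `P` is closed
under equalisers. -/
lemma IsBase.prop_of_retract {X Y : Cat.{u, u}} (r : Retract X Y) (hY : P Y) : P X := by
  have := IsBase.closedUnderLimits (P := P) (ULiftHom.{u} (ULift.{u} WalkingParallelPair))
  have : P.IsClosedUnderLimitsOfShape WalkingParallelPair :=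
    ObjectProperty.IsClosedUnderLimitsOfShape.of_equivalence
      (ULiftHomULiftCategory.equiv.{u, u} WalkingParallelPair).symm
  refine P.prop_of_isLimit (isSplitMonoEqualizes r.i) ?_
  rintro (_ | _) <;> exact hY

/-- $[0]$ is a retract of $[1]$, and $[2]$ is a retract of $[1]\times[1]$. -/
lemma IsBase.prop_ordCat (n : ℕ) (hn : n ≤ 2) : P (ordCat.{u} n) := by
  have h1 : P (ordCat.{u} 1) := IsBase.prop_two
  interval_cases n
  · refine IsBase.prop_of_retract P (Y := ordCat.{u} 1)
      ⟨(Monotone.functor (f := fun _ => ⟨0⟩) (fun _ _ _ => le_rfl)).toCatHom,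
        (Monotone.functor (f := fun _ => ⟨0⟩) (fun _ _ _ => le_rfl)).toCatHom, ?_⟩ h1
    ext1
    exact functor_ext_of_preorder (α := ULift.{u} (Fin 1)) fun x =>
      ULift.ext _ _ (Subsingleton.elim (α := Fin 1) _ _)
  · exact h1
  · have h2 : P (Cat.of (ULift.{u} (Fin 2) × ULift.{u} (Fin 2))) :=
      ObjectProperty.prop_tensor h1 h1
    -- The section is the chain $(0,0)<(0,1)<(1,1)$ in the square; the retraction `r` adds the two
    -- coordinates, so it sends both middle corners to $1$.
    let i₁ : ULift.{u} (Fin 3) → ULift.{u} (Fin 2) := fun a => ⟨if a.down = 2 then 1 else 0⟩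
    let i₂ : ULift.{u} (Fin 3) → ULift.{u} (Fin 2) := fun a => ⟨if a.down = 0 then 0 else 1⟩
    have hi₁ : Monotone i₁ := by rintro ⟨a⟩ ⟨b⟩; revert a b; simp only [i₁, ULift.up_le]; decide
    have hi₂ : Monotone i₂ := by rintro ⟨a⟩ ⟨b⟩; revert a b; simp only [i₂, ULift.up_le]; decide
    let r : ULift.{u} (Fin 2) × ULift.{u} (Fin 2) → ULift.{u} (Fin 3) := fun a =>
      ⟨if a.1.down = 0 then (if a.2.down = 0 then 0 else 1) else if a.2.down = 0 then 1 else 2⟩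
    have hr : ∀ a b, a.1 ≤ b.1 → a.2 ≤ b.2 → r a ≤ r b := by
      rintro ⟨⟨a⟩, ⟨a'⟩⟩ ⟨⟨b⟩, ⟨b'⟩⟩; revert a a' b b'; simp only [r, ULift.up_le]; decide
    refine IsBase.prop_of_retract P ⟨(Functor.prod' hi₁.functor hi₂.functor).toCatHom,
      Functor.toCatHom
        { obj := r
          map := fun {a b} f => homOfLE (hr a b (leOfHom f.1) (leOfHom f.2)) }, ?_⟩ h2
    ext1
    refine functor_ext_of_preorder (α := ULift.{u} (Fin 3)) fun x => ?_
    obtain ⟨x⟩ := x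
    refine ULift.ext _ _ ?_
    revert x
    change ∀ x : Fin 3, (r ⟨i₁ ⟨x⟩, i₂ ⟨x⟩⟩).down = x
    simp only [r, i₁, i₂]
    decide

/-- The category `0 ⟶ 1 ⟶ ⋯ ⟶ n` as an object of a base of enrichment, for `n ≤ 2`. -/
abbrev ordBase (n : Fin 3) : P.FullSubcategory :=
  ⟨ordCat.{u} n, IsBase.prop_ordCat P n (Nat.le_of_lt_succ n.2)⟩

/-- The inclusion of the base in `Cat` is fully faithful, so it reflects colimits. It need not
preserve them, which is why the test objects must lie in the base. -/
lemma nonempty_isColimit_of_ordBase {𝒟 : Type*} [Category* 𝒟] {F : 𝒟 ⥤ P.FullSubcategory}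
    (c : Cocone F)
    (h : ∀ n, Nonempty (IsColimit ((coyoneda.obj (op (ordBase P n))).mapCocone c))) :
    Nonempty (IsColimit c) := by
  obtain ⟨hc⟩ := nonempty_isColimit_of_ordCat (P.ι.mapCocone c) fun n hn => by
    let e : coyoneda.obj (op (ordBase P ⟨n, Nat.lt_succ_of_le hn⟩)) ≅
        P.ι ⋙ coyoneda.obj (op (ordCat.{u} n)) :=
      NatIso.ofComponents (fun X => P.fullyFaithfulι.homEquiv.toIso) (fun _ => rfl)
    exact ⟨IsColimit.mapCoconeEquiv e (h ⟨n, Nat.lt_succ_of_le hn⟩).some⟩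
  exact ⟨isColimitOfReflects P.ι hc⟩

end Base

/-! ### Whiskering in the arrow category is componentwise. -/

section Whisker

variable (V : Type u₁) [Category.{v₁} V] [MonoidalCategory V] [HasPullbacks V]
variable {C : Type u₂} [Category.{v₂} C] [EnrichedOrdinaryCategory V C]

lemma eHomWhiskerLeft_arrowFst (g : Arrow C) {f f' : Arrow C} (s : f ⟶ f') :
    eHomWhiskerLeft V g s ≫ arrowFst V g f' =
      arrowFst V g f ≫ eHomWhiskerLeft V g.left s.left := by
  have h1 : eHomEquiv V s ≫ arrowFst V f f' = eHomEquiv V s.left := arrowElt_fst V s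
  have h2 : eComp V g f f' ≫ arrowFst V g f' =
    (arrowFst V g f ⊗ₘ arrowFst V f f') ≫ eComp V _ _ _ := arrowComp_fst V g f f'
  simp only [eHomWhiskerLeft, Category.assoc]
  rw [h2, ← h1, ← id_tensorHom, ← id_tensorHom, tensorHom_comp_tensorHom_assoc,
    rightUnitor_inv_naturality_assoc]
  rw [← tensorHom_id, tensorHom_comp_tensorHom_assoc]
  simp only [Category.id_comp, Category.comp_id]
  rfl

lemma eHomWhiskerLeft_arrowSnd (g : Arrow C) {f f' : Arrow C} (s : f ⟶ f') :
    eHomWhiskerLeft V g s ≫ arrowSnd V g f' =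
      arrowSnd V g f ≫ eHomWhiskerLeft V g.right s.right := by
  have h1 : eHomEquiv V s ≫ arrowSnd V f f' = eHomEquiv V s.right := arrowElt_snd V s
  have h2 : eComp V g f f' ≫ arrowSnd V g f' =
    (arrowSnd V g f ⊗ₘ arrowSnd V f f') ≫ eComp V _ _ _ := arrowComp_snd V g f f'
  simp only [eHomWhiskerLeft, Category.assoc]
  rw [h2, ← h1, ← id_tensorHom, ← id_tensorHom, tensorHom_comp_tensorHom_assoc,
    rightUnitor_inv_naturality_assoc]
  rw [← tensorHom_id, tensorHom_comp_tensorHom_assoc]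
  simp only [Category.id_comp, Category.comp_id]
  rfl

lemma eHomWhiskerRight_arrowFst {g g' : Arrow C} (s : g ⟶ g') (f : Arrow C) :
    eHomWhiskerRight V s f ≫ arrowFst V g f =
      arrowFst V g' f ≫ eHomWhiskerRight V s.left f.left := by
  have h1 : eHomEquiv V s ≫ arrowFst V g g' = eHomEquiv V s.left := arrowElt_fst V s
  have h2 : eComp V g g' f ≫ arrowFst V g f =
    (arrowFst V g g' ⊗ₘ arrowFst V g' f) ≫ eComp V _ _ _ := arrowComp_fst V g g' f
  simp only [eHomWhiskerRight, Category.assoc]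
  rw [h2, ← h1, ← tensorHom_id, ← tensorHom_id, tensorHom_comp_tensorHom_assoc,
    leftUnitor_inv_naturality_assoc]
  rw [← id_tensorHom, tensorHom_comp_tensorHom_assoc]
  simp only [Category.id_comp, Category.comp_id]
  rfl

lemma eHomWhiskerRight_arrowSnd {g g' : Arrow C} (s : g ⟶ g') (f : Arrow C) :
    eHomWhiskerRight V s f ≫ arrowSnd V g f =
      arrowSnd V g' f ≫ eHomWhiskerRight V s.right f.right := by
  have h1 : eHomEquiv V s ≫ arrowSnd V g g' = eHomEquiv V s.right := arrowElt_snd V s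
  have h2 : eComp V g g' f ≫ arrowSnd V g f =
    (arrowSnd V g g' ⊗ₘ arrowSnd V g' f) ≫ eComp V _ _ _ := arrowComp_snd V g g' f
  simp only [eHomWhiskerRight, Category.assoc]
  rw [h2, ← h1, ← tensorHom_id, ← tensorHom_id, tensorHom_comp_tensorHom_assoc,
    leftUnitor_inv_naturality_assoc]
  rw [← id_tensorHom, tensorHom_comp_tensorHom_assoc]
  simp only [Category.id_comp, Category.comp_id]
  rfl

end Whisker

/-! ### Tensors represent generalised elements of hom-objects. -/

section Tensor

variable {V : Type u₁} [Category.{v₁} V] [MonoidalCategory V] [MonoidalClosed V]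
variable {C : Type u₂} [Category.{v₁} C] [EnrichedOrdinaryCategory V C]

/-- Evaluates the enriched comparison map of a tensor on an element `f`: up to transposition it is
$\eta$ followed by postcomposition with `f`. -/
lemma eHomEquiv_comp_curry {v : V} {X T : C} (η : v ⟶ (X ⟶[V] T)) {Y : C} (f : T ⟶ Y) :
    eHomEquiv V f ≫ MonoidalClosed.curry (η ▷ (T ⟶[V] Y) ≫ eComp V X T Y) =
      MonoidalClosed.curry ((ρ_ v).hom ≫ η ≫ eHomWhiskerLeft V X f) := by
  rw [← MonoidalClosed.curry_natural_left, whisker_exchange_assoc, eHomWhiskerLeft,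
    rightUnitor_inv_naturality_assoc]
  simp

/-- Morphisms out of a tensor `v ⊗ X` are morphisms from `v` to the hom-objects out of `X`. -/
lemma nonempty_coyoneda_iso_of_tensor {v : V} {X T : C} (η : v ⟶ (X ⟶[V] T))
    (h : ∀ Y : C, IsIso (MonoidalClosed.curry (η ▷ (T ⟶[V] Y) ≫ eComp V X T Y))) :
    Nonempty (coyoneda.obj (op T) ≅
      (eHomFunctor V C).obj (op X) ⋙ coyoneda.obj (op v)) := by
  let φ (Y : C) : (T ⟶ Y) ≃ (v ⟶ (X ⟶[V] Y)) :=
    (eHomEquiv V).trans <| ((asIso (MonoidalClosed.curry (η ▷ (T ⟶[V] Y) ≫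
      eComp V X T Y))).homToEquiv).trans <|
      ((ihom.adjunction v).homEquiv _ _).symm.trans ((ρ_ v).homFromEquiv)
  -- This closed form makes naturality in `Y` just the functoriality of whiskering.
  have hφ (Y : C) (f : T ⟶ Y) : φ Y f = η ≫ eHomWhiskerLeft V X f := by
    have := congrArg MonoidalClosed.uncurry (eHomEquiv_comp_curry η f)
    rw [MonoidalClosed.uncurry_curry] at this
    exact (congrArg ((ρ_ v).inv ≫ ·) this).trans (by simp)
  refine ⟨NatIso.ofComponents (fun Y => (φ Y).toIso) fun {Y Y'} s => ?_⟩
  ext f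
  change φ Y' (f ≫ s) = φ Y f ≫ eHomWhiskerLeft V X s
  rw [hφ, hφ, eHomWhiskerLeft_comp, Category.assoc]

end Tensor

/-! ### Filtered colimits and the hom-objects of the arrow category. -/

section Filtered

variable {V : Type u₁} [Category.{v₁} V] [MonoidalCategory V]
variable {C : Type u₂} [Category.{v₂} C] [EnrichedOrdinaryCategory V C]
variable {𝒟 : Type w} [Category.{w'} 𝒟]

lemma exists_eq_comp_eHomWhiskerLeft {F : 𝒟 ⥤ C} {c : Cocone F} {A : C} {T : V}
    (h : IsColimit (((eHomFunctor V C).obj (op A) ⋙ coyoneda.obj (op T)).mapCocone c))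
    (a : T ⟶ (A ⟶[V] c.pt)) :
    ∃ d, ∃ a' : T ⟶ (A ⟶[V] F.obj d), a' ≫ eHomWhiskerLeft V A (c.ι.app d) = a :=
  Types.jointly_surjective_of_isColimit h a

variable [IsFiltered 𝒟]

lemma exists_comp_eHomWhiskerLeft_eq {F : 𝒟 ⥤ C} {c : Cocone F} {A : C} {T : V}
    (h : IsColimit (((eHomFunctor V C).obj (op A) ⋙ coyoneda.obj (op T)).mapCocone c))
    {d : 𝒟} (a a' : T ⟶ (A ⟶[V] F.obj d))
    (haa' : a ≫ eHomWhiskerLeft V A (c.ι.app d) = a' ≫ eHomWhiskerLeft V A (c.ι.app d)) :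
    ∃ (d' : 𝒟) (φ : d ⟶ d'),
      a ≫ eHomWhiskerLeft V A (F.map φ) = a' ≫ eHomWhiskerLeft V A (F.map φ) :=
  (Types.FilteredColimit.isColimit_eq_iff' h a a').1 haa'

/-- Filtered colimits commute with the pullbacks that define the hom-objects of `C^2`. -/
lemma nonempty_isColimit_arrowHom [HasPullbacks V] {F : 𝒟 ⥤ Arrow C} (c : Cocone F)
    (g : Arrow C) (T : V)
    (h₁ : IsColimit (((eHomFunctor V C).obj (op g.left) ⋙ coyoneda.obj (op T)).mapCocone
      (Arrow.leftFunc.mapCocone c)))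
    (h₂ : IsColimit (((eHomFunctor V C).obj (op g.left) ⋙ coyoneda.obj (op T)).mapCocone
      (Arrow.rightFunc.mapCocone c)))
    (h₃ : IsColimit (((eHomFunctor V C).obj (op g.right) ⋙ coyoneda.obj (op T)).mapCocone
      (Arrow.rightFunc.mapCocone c))) :
    Nonempty (IsColimit (((eHomFunctor V (Arrow C)).obj (op g) ⋙
      coyoneda.obj (op T)).mapCocone c)) := by
  have wl {d d' : 𝒟} (φ : d ⟶ d') : eHomWhiskerLeft V g.left (F.map φ).left ≫
      eHomWhiskerLeft V g.left (c.ι.app d').left =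
        eHomWhiskerLeft V g.left (c.ι.app d).left := by
    rw [← eHomWhiskerLeft_comp, ← Arrow.comp_left, c.w]
  have wr (A : C) {d d' : 𝒟} (φ : d ⟶ d') : eHomWhiskerLeft V A (F.map φ).right ≫
      eHomWhiskerLeft V A (c.ι.app d').right =
        eHomWhiskerLeft V A (c.ι.app d).right := by
    rw [← eHomWhiskerLeft_comp, ← Arrow.comp_right, c.w]
  have s₁ (a : T ⟶ (g.left ⟶[V] c.pt.left)) : ∃ d, ∃ a' : T ⟶ (g.left ⟶[V] (F.obj d).left),
      a' ≫ eHomWhiskerLeft V g.left (c.ι.app d).left = a := exists_eq_comp_eHomWhiskerLeft h₁ a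
  have s₃ (a : T ⟶ (g.right ⟶[V] c.pt.right)) : ∃ d, ∃ a' : T ⟶ (g.right ⟶[V] (F.obj d).right),
      a' ≫ eHomWhiskerLeft V g.right (c.ι.app d).right = a := exists_eq_comp_eHomWhiskerLeft h₃ a
  have i₁ {d : 𝒟} (a a' : T ⟶ (g.left ⟶[V] (F.obj d).left))
      (h : a ≫ eHomWhiskerLeft V g.left (c.ι.app d).left =
        a' ≫ eHomWhiskerLeft V g.left (c.ι.app d).left) : ∃ (d' : 𝒟) (φ : d ⟶ d'),
      a ≫ eHomWhiskerLeft V g.left (F.map φ).left =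
        a' ≫ eHomWhiskerLeft V g.left (F.map φ).left := exists_comp_eHomWhiskerLeft_eq h₁ a a' h
  have i₂ {d : 𝒟} (a a' : T ⟶ (g.left ⟶[V] (F.obj d).right))
      (h : a ≫ eHomWhiskerLeft V g.left (c.ι.app d).right =
        a' ≫ eHomWhiskerLeft V g.left (c.ι.app d).right) : ∃ (d' : 𝒟) (φ : d ⟶ d'),
      a ≫ eHomWhiskerLeft V g.left (F.map φ).right =
        a' ≫ eHomWhiskerLeft V g.left (F.map φ).right := exists_comp_eHomWhiskerLeft_eq h₂ a a' h
  have i₃ {d : 𝒟} (a a' : T ⟶ (g.right ⟶[V] (F.obj d).right))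
      (h : a ≫ eHomWhiskerLeft V g.right (c.ι.app d).right =
        a' ≫ eHomWhiskerLeft V g.right (c.ι.app d).right) : ∃ (d' : 𝒟) (φ : d ⟶ d'),
      a ≫ eHomWhiskerLeft V g.right (F.map φ).right =
        a' ≫ eHomWhiskerLeft V g.right (F.map φ).right := exists_comp_eHomWhiskerLeft_eq h₃ a a' h
  have el (d : 𝒟) : eHomWhiskerLeft V g (c.ι.app d) ≫ arrowFst V g c.pt =
      arrowFst V g (F.obj d) ≫ eHomWhiskerLeft V g.left (c.ι.app d).left :=
    eHomWhiskerLeft_arrowFst V g (c.ι.app d)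
  have er (d : 𝒟) : eHomWhiskerLeft V g (c.ι.app d) ≫ arrowSnd V g c.pt =
      arrowSnd V g (F.obj d) ≫ eHomWhiskerLeft V g.right (c.ι.app d).right :=
    eHomWhiskerLeft_arrowSnd V g (c.ι.app d)
  -- A `T`-element of $\mathcal C^{\mathbf 2}(g,f)$ is a compatible pair of `T`-elements. It must be
  -- shown that each such pair over the colimit comes from a stage, and that two that agree in the
  -- colimit agree at a later stage.
  refine ⟨Types.FilteredColimit.isColimitOf' _ _ (fun x => ?_) fun d x y hxy => ?_⟩
  · change T ⟶ arrowHom V g c.pt at x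
    obtain ⟨d₁, a₁, ha₁⟩ := s₁ (x ≫ arrowFst V g c.pt)
    obtain ⟨d₂, b₁, hb₁⟩ := s₃ (x ≫ arrowSnd V g c.pt)
    obtain ⟨d₃, a₂, b₂, ha₂, hb₂⟩ : ∃ (d : 𝒟) (a : T ⟶ (g.left ⟶[V] (F.obj d).left))
        (b : T ⟶ (g.right ⟶[V] (F.obj d).right)),
        a ≫ eHomWhiskerLeft V g.left (c.ι.app d).left = x ≫ arrowFst V g c.pt ∧
        b ≫ eHomWhiskerLeft V g.right (c.ι.app d).right = x ≫ arrowSnd V g c.pt :=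
      ⟨IsFiltered.max d₁ d₂,
        a₁ ≫ eHomWhiskerLeft V g.left (F.map (IsFiltered.leftToMax d₁ d₂)).left,
        b₁ ≫ eHomWhiskerLeft V g.right (F.map (IsFiltered.rightToMax d₁ d₂)).right,
        by rw [← ha₁, Category.assoc, wl], by rw [← hb₁, Category.assoc, wr]⟩
    -- The two components now live at one stage, but are compatible only over the colimit. Their two
    -- images in $\mathcal C(\mathrm{dom}\,g,\mathrm{cod}\,-)$ become equal there, hence already at
    -- a later stage.
    obtain ⟨d₄, φ, hφ⟩ := i₂ (d := d₃)
      (a₂ ≫ eHomWhiskerLeft V g.left (F.obj d₃).hom)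
      (b₂ ≫ eHomWhiskerRight V g.hom (F.obj d₃).right) (by
        have hw : (c.ι.app d₃).left ≫ c.pt.hom = _ := Arrow.w (c.ι.app d₃)
        rw [Category.assoc, Category.assoc, ← eHomWhiskerLeft_comp, ← hw,
          ← eHom_whisker_exchange, reassoc_of% hb₂, eHomWhiskerLeft_comp, reassoc_of% ha₂]
        exact congrArg (x ≫ ·) (arrow_condition V g c.pt))
    have hw := Arrow.w (F.map φ)
    refine ⟨d₄, arrowLift V (f := g) (g := F.obj d₄) (a₂ ≫ eHomWhiskerLeft V g.left (F.map φ).left)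
      (b₂ ≫ eHomWhiskerLeft V g.right (F.map φ).right) ?_, ?_⟩
    · rw [Category.assoc, Category.assoc, ← eHomWhiskerLeft_comp, hw, eHom_whisker_exchange,
        eHomWhiskerLeft_comp, ← Category.assoc, hφ, Category.assoc]
    · change x = _ ≫ eHomWhiskerLeft V g (c.ι.app d₄)
      apply arrowHom_ext
      · rw [Category.assoc, el, ← Category.assoc, arrowLift_fst,
          Category.assoc, wl, ha₂]
      · rw [Category.assoc, er, ← Category.assoc, arrowLift_snd,
          Category.assoc, wr, hb₂]
  · change T ⟶ arrowHom V g (F.obj d) at x y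
    change x ≫ eHomWhiskerLeft V g (c.ι.app d) = y ≫ eHomWhiskerLeft V g (c.ι.app d) at hxy
    obtain ⟨d₁, φ₁, h₁⟩ := i₁
      (x ≫ arrowFst V g (F.obj d)) (y ≫ arrowFst V g (F.obj d)) (by
        rw [Category.assoc, Category.assoc, ← el, reassoc_of% hxy])
    obtain ⟨d₂, φ₂, h₂⟩ := i₃
      (x ≫ arrowSnd V g (F.obj d)) (y ≫ arrowSnd V g (F.obj d)) (by
        rw [Category.assoc, Category.assoc, ← er, reassoc_of% hxy])
    -- The components are equalised along different maps out of `d`; filteredness gives a map out of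
    -- `d` that factors through both.
    obtain ⟨d₃, ψ₁, ψ₂, hψ⟩ := IsFiltered.span φ₁ φ₂
    refine ⟨d₃, φ₁ ≫ ψ₁, ?_⟩
    change x ≫ eHomWhiskerLeft V g (F.map (φ₁ ≫ ψ₁)) = y ≫ eHomWhiskerLeft V g (F.map (φ₁ ≫ ψ₁))
    apply arrowHom_ext
    · rw [Category.assoc, Category.assoc, eHomWhiskerLeft_arrowFst, F.map_comp, Arrow.comp_left,
        eHomWhiskerLeft_comp]
      simpa only [Category.assoc] using
        congrArg (· ≫ eHomWhiskerLeft V g.left (F.map ψ₁).left) h₁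
    · rw [Category.assoc, Category.assoc, eHomWhiskerLeft_arrowSnd, hψ, F.map_comp,
        Arrow.comp_right, eHomWhiskerLeft_comp]
      simpa only [Category.assoc] using
        congrArg (· ≫ eHomWhiskerLeft V g.right (F.map ψ₂).right) h₂

end Filtered

/-! ### A common bound for a small family of ranks. -/

section Rank

variable {C : Type u₂} [Category.{v₂} C]

lemma HasRankLE.of_le {M : MorphismProperty C} {A : C} {κ κ' : Cardinal.{w}} [Fact κ.IsRegular]
    [Fact κ'.IsRegular] (hA : HasRankLE M A κ) (h : κ ≤ κ') : HasRankLE M A κ' :=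
  fun 𝒟 _ _ X m hm =>
    have : IsCardinalFiltered 𝒟 κ := IsCardinalFiltered.of_le 𝒟 h
    hA 𝒟 X m hm

/-- Ranks can be enlarged, and the successor of an infinite cardinal is regular; so the successor of
the supremum works, the maximum with $\aleph_0$ ensuring infinitude. -/
lemma exists_hasRankLE_forall {M : MorphismProperty C}
    (h : ∀ A : C, ∃ (κ : Cardinal.{w}) (_ : Fact κ.IsRegular), HasRankLE M A κ)
    {I : Type w} (A : I → C) :
    ∃ (κ : Cardinal.{w}) (_ : Fact κ.IsRegular), ∀ i, HasRankLE M (A i) κ := by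
  choose κ hκ hA using fun i => h (A i)
  refine ⟨Order.succ (max Cardinal.aleph0 (⨆ i, κ i)),
    ⟨Cardinal.isRegular_succ (le_max_left _ _)⟩, fun i => ?_⟩
  have : Fact (Order.succ (max Cardinal.aleph0 (⨆ i, κ i))).IsRegular :=
    ⟨Cardinal.isRegular_succ (le_max_left _ _)⟩
  exact (hA i).of_le (((le_ciSup Cardinal.bddAbove_of_small i).trans
    (le_max_right _ _)).trans (Order.le_succ _))

end Rank

/-! ### Enriched functors and whiskering of natural transformations. -/

section Underlying

variable {V : Type u₁} [Category.{v₁} V] [MonoidalCategory V]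
variable {D : Type u₂} [Category.{v₂} D] [EnrichedOrdinaryCategory V D]
variable {C : Type u₃} [Category.{v₃} C] [EnrichedOrdinaryCategory V C]
variable {E : Type u₄} [Category.{v₄} E] [EnrichedOrdinaryCategory V E]

lemma mapHom_functor_comp (F : EnrichedFunctor V D C) (G : EnrichedFunctor V C E) {X Y : D}
    (f : X ⟶ Y) : mapHom (F.comp V G) f = mapHom G (mapHom F f) := by
  refine (eHomEquiv V).injective ((eHomEquiv_mapHom (F.comp V G) f).trans
    (Eq.trans ?_ (eHomEquiv_mapHom G (mapHom F f)).symm))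
  exact ((congrArg (· ≫ G.map _ _) (eHomEquiv_mapHom F f)).trans (Category.assoc _ _ _)).symm

lemma map_eHomWhiskerLeft (F : EnrichedFunctor V D C) (X : D) {Y Y' : D} (s : Y ⟶ Y') :
    F.map X Y ≫ eHomWhiskerLeft V (F.obj X) (mapHom F s) =
      eHomWhiskerLeft V X s ≫ F.map X Y' := by
  simp only [eHomWhiskerLeft, Category.assoc, EnrichedFunctor.map_comp, eHomEquiv_mapHom]
  rw [rightUnitor_inv_naturality_assoc, MonoidalCategory.tensorHom_def]
  simp only [MonoidalCategory.whiskerLeft_comp, Category.assoc]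
  rw [whisker_exchange_assoc]

lemma map_eHomWhiskerRight (F : EnrichedFunctor V D C) {X X' : D} (s : X ⟶ X') (Y : D) :
    F.map X' Y ≫ eHomWhiskerRight V (mapHom F s) (F.obj Y) =
      eHomWhiskerRight V s Y ≫ F.map X Y := by
  simp only [eHomWhiskerRight, Category.assoc, EnrichedFunctor.map_comp, eHomEquiv_mapHom]
  rw [leftUnitor_inv_naturality_assoc, tensorHom_def']
  simp only [comp_whiskerRight, Category.assoc]
  rw [whisker_exchange_assoc]

lemma IsVNatural.comp_functor {D : Type u₂} [EnrichedCategory V D] {F G : EnrichedFunctor V D C}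
    {τ : ∀ d, F.obj d ⟶ G.obj d} (h : IsVNatural V F G τ) (K : EnrichedFunctor V C E) :
    IsVNatural V (F.comp V K) (G.comp V K) fun d => mapHom K (τ d) := fun d d' => by
  refine (Category.assoc _ _ _).trans ((congrArg _ (map_eHomWhiskerLeft K _ _)).trans ?_)
  refine Eq.trans ?_ ((Category.assoc _ _ _).trans
    (congrArg _ (map_eHomWhiskerRight K _ _))).symm
  exact (Category.assoc _ _ _).symm.trans
    ((congrArg (· ≫ K.map _ _) (h d d')).trans (Category.assoc _ _ _))

lemma IsVNatural.congr {D : Type u₂} [EnrichedCategory V D] {F G : EnrichedFunctor V D C}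
    {τ τ' : ∀ d, F.obj d ⟶ G.obj d} (h : IsVNatural V F G τ) (e : ∀ d, τ d = τ' d) :
    IsVNatural V F G τ' := (funext e : τ = τ') ▸ h

lemma IsVNatural.functor_comp {B : Type u₄} [EnrichedCategory V B] {D : Type u₂}
    [EnrichedCategory V D] {F G : EnrichedFunctor V D C} {τ : ∀ d, F.obj d ⟶ G.obj d}
    (h : IsVNatural V F G τ) (H : EnrichedFunctor V B D) :
    IsVNatural V (H.comp V F) (H.comp V G) fun b => τ (H.obj b) := fun _ _ =>
  (Category.assoc _ _ _).trans ((congrArg _ (h _ _)).trans (Category.assoc _ _ _).symm)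

end Underlying

/-! ### Functors and natural transformations into the arrow category. -/

section ArrowFunctors

variable {V : Type u₁} [Category.{v₁} V] [MonoidalCategory V] [HasPullbacks V]
variable {C : Type u₃} [Category.{v₃} C] [EnrichedOrdinaryCategory V C]

lemma mapHom_domFunctor {f g : Arrow C} (s : f ⟶ g) : mapHom (domFunctor V C) s = s.left :=
  (eHomEquiv V).injective ((eHomEquiv_mapHom _ _).trans (arrowElt_fst V s))

lemma mapHom_codFunctor {f g : Arrow C} (s : f ⟶ g) : mapHom (codFunctor V C) s = s.right :=
  (eHomEquiv V).injective ((eHomEquiv_mapHom _ _).trans (arrowElt_snd V s))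

lemma mapHom_toArrow_left {D : Type u₂} [Category.{v₂} D] [EnrichedOrdinaryCategory V D]
    (F G : EnrichedFunctor V D C) (τ : ∀ d, F.obj d ⟶ G.obj d) (h : IsVNatural V F G τ)
    {d d' : D} (s : d ⟶ d') : (mapHom (toArrow F G τ h) s).left = mapHom F s := by
  rw [← mapHom_domFunctor (V := V), ← mapHom_functor_comp]
  refine (eHomEquiv V).injective ((eHomEquiv_mapHom ((toArrow F G τ h).comp V _) s).trans
    (Eq.trans ?_ (eHomEquiv_mapHom F s).symm))
  exact congrArg (eHomEquiv V s ≫ ·) (arrowLift_fst V _ _ _)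

lemma mapHom_toArrow_right {D : Type u₂} [Category.{v₂} D] [EnrichedOrdinaryCategory V D]
    (F G : EnrichedFunctor V D C) (τ : ∀ d, F.obj d ⟶ G.obj d) (h : IsVNatural V F G τ)
    {d d' : D} (s : d ⟶ d') : (mapHom (toArrow F G τ h) s).right = mapHom G s := by
  rw [← mapHom_codFunctor (V := V), ← mapHom_functor_comp]
  refine (eHomEquiv V).injective ((eHomEquiv_mapHom ((toArrow F G τ h).comp V _) s).trans
    (Eq.trans ?_ (eHomEquiv_mapHom G s).symm))
  exact congrArg (eHomEquiv V s ≫ ·) (arrowLift_snd V _ _ _)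

/-- Maps into a hom-object of $\mathcal C^{\mathbf 2}$ are determined by the two projections, so
enriched naturality may be checked on domains and on codomains. -/
lemma IsVNatural.toArrow {D : Type u₂} [EnrichedCategory V D] {F G F' G' : EnrichedFunctor V D C}
    {τ : ∀ d, F.obj d ⟶ G.obj d} {τ' : ∀ d, F'.obj d ⟶ G'.obj d} (h : IsVNatural V F G τ)
    (h' : IsVNatural V F' G' τ') (s : ∀ d, Arrow.mk (τ d) ⟶ Arrow.mk (τ' d))
    (hl : IsVNatural V F F' fun d => (s d).left) (hr : IsVNatural V G G' fun d => (s d).right) :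
    IsVNatural V (toArrow F G τ h) (toArrow F' G' τ' h') s := fun d d' => by
  apply arrowHom_ext
  · refine (Category.assoc _ _ _).trans
      ((congrArg (_ ≫ ·) (eHomWhiskerLeft_arrowFst V _ (s d'))).trans ?_)
    refine Eq.trans ?_ ((Category.assoc _ _ _).trans
      (congrArg (_ ≫ ·) (eHomWhiskerRight_arrowFst V (s d) _))).symm
    refine (Category.assoc _ _ _).symm.trans (Eq.trans ?_ (Category.assoc _ _ _))
    refine (congrArg (· ≫ eHomWhiskerLeft V (F.obj d) (s d').left)
      (arrowLift_fst V _ _ (h d d'))).trans ((hl d d').trans ?_)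
    exact (congrArg (· ≫ eHomWhiskerRight V (s d).left (F'.obj d'))
      (arrowLift_fst V _ _ (h' d d'))).symm
  · refine (Category.assoc _ _ _).trans
      ((congrArg (_ ≫ ·) (eHomWhiskerLeft_arrowSnd V _ (s d'))).trans ?_)
    refine Eq.trans ?_ ((Category.assoc _ _ _).trans
      (congrArg (_ ≫ ·) (eHomWhiskerRight_arrowSnd V (s d) _))).symm
    refine (Category.assoc _ _ _).symm.trans (Eq.trans ?_ (Category.assoc _ _ _))
    refine (congrArg (· ≫ eHomWhiskerLeft V (G.obj d) (s d').right)
      (arrowLift_snd V _ _ (h d d'))).trans ((hr d d').trans ?_)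
    exact (congrArg (· ≫ eHomWhiskerRight V (s d).right (G'.obj d'))
      (arrowLift_snd V _ _ (h' d d'))).symm

end ArrowFunctors

/-! ### The arrows $\mathcal C(\mathrm{cod}\,g,\mathrm{dom} f)\to\mathcal C^{\mathbf 2}(g,f)$ as
functors of both variables. -/

section Representables

variable {V : Type u₁} [Category.{v₁} V] [MonoidalCategory V] [MonoidalClosed V]
variable {C : Type u₃} [Category.{v₃} C] [EnrichedOrdinaryCategory V C]

lemma mapHom_covHom (A : C) {X Y : C} (s : X ⟶ Y) :
    mapHom (covHom (V := V) A) s = eHomWhiskerLeft V A s := by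
  refine (eHomEquiv V).injective ((eHomEquiv_mapHom (covHom (V := V) A) s).trans ?_)
  refine Eq.trans ?_ (MonoidalClosed.enrichedOrdinaryCategorySelf_homEquiv V _).symm
  refine (MonoidalClosed.curry_natural_left _ _).symm.trans ?_
  exact congrArg MonoidalClosed.curry
    (Iso.hom_inv_id_assoc (ρ_ (A ⟶[V] X)) (_ ◁ eHomEquiv V s ≫ eComp V A X Y)).symm

section

variable [HasPullbacks V]

lemma mapHom_diagCov_left (g : Arrow C) {f f' : Arrow C} (s : f ⟶ f') :
    (mapHom (diagCov V g) s).left = eHomWhiskerLeft V g.right s.left := by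
  refine (mapHom_toArrow_left _ _ _ _ s).trans ?_
  rw [mapHom_functor_comp, mapHom_covHom, mapHom_domFunctor]
  rfl

lemma mapHom_diagCov_right (g : Arrow C) {f f' : Arrow C} (s : f ⟶ f') :
    (mapHom (diagCov V g) s).right = eHomWhiskerLeft V g s :=
  (mapHom_toArrow_right _ _ _ _ s).trans (mapHom_covHom g s)

end

variable [BraidedCategory V]

/-- Postcomposition commutes with precomposition, by associativity; the braiding only accounts for
the order of factors in the contravariant action. -/
lemma isVNatural_contraHom {X X' : C} (s : X ⟶ X') :
    IsVNatural V (contraHom (V := V) X) (contraHom X') fun A => eHomWhiskerLeft V A.unop s :=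
  isVNatural_of_uncurry _ _ _ fun A B => by
    refine (congrArg (· ≫ _) (MonoidalClosed.uncurry_curry _)).trans ?_
    refine Eq.trans ?_ (congrArg _ (MonoidalClosed.uncurry_curry _)).symm
    refine (Category.assoc _ _ _).trans ((congrArg _ (eComp_eHomWhiskerLeft V _ _ s)).trans ?_)
    exact (BraidedCategory.braiding_naturality_left_assoc _ _ _).symm

variable [HasPullbacks V]

/-- Links the two variances: the action of `s` for fixed `g` is enriched-natural in `g`. This is
what lets naturality in $i$ of the structures pass to the colimit. -/
lemma isVNatural_diagContra {f f' : Arrow C} (s : f ⟶ f') :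
    IsVNatural V (diagContra V f) (diagContra V f') fun g => mapHom (diagCov V g.unop) s :=
  IsVNatural.toArrow (F := (opFunctor (codFunctor V C)).comp V (contraHom f.left))
    (F' := (opFunctor (codFunctor V C)).comp V (contraHom f'.left))
    (G := contraHom f) (G' := contraHom f') (τ := fun g => arrowDiag V g.unop f)
    (τ' := fun g => arrowDiag V g.unop f') _ _ (fun g => mapHom (diagCov V g.unop) s)
    (by
      have h := (isVNatural_contraHom (V := V) s.left).functor_comp (opFunctor (codFunctor V C))
      exact h.congr fun g => (mapHom_diagCov_left g.unop s).symm)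
    (by
      have h := isVNatural_contraHom (V := V) s
      exact h.congr fun g => (mapHom_diagCov_right g.unop s).symm)

end Representables

/-! ### Algebras: functoriality of composition, and inheritance along jointly epimorphic families.
-/

section AWFS

variable {V : Type u₁} [Category.{v₁} V] [MonoidalCategory V] [HasPullbacks V]
variable {C : Type u₂} [Category.{v₂} C] [EnrichedOrdinaryCategory V C]

namespace FunctorialFactorisation

variable (𝓕 : FunctorialFactorisation V C)

lemma Kmap_comp {f g h : Arrow C} (s : f ⟶ g) (t : g ⟶ h) :
    𝓕.Kmap (s ≫ t) = 𝓕.Kmap s ≫ 𝓕.Kmap t := mapHom_comp 𝓕.K s t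

/-- The comonad's underlying functor on commutative squares. -/
noncomputable abbrev Lmap {f g : Arrow C} (s : f ⟶ g) :
    Arrow.mk (𝓕.lam f) ⟶ Arrow.mk (𝓕.lam g) :=
  Arrow.homMk s.left (𝓕.Kmap s) (𝓕.lam_Kmap s).symm

/-- The monad's underlying functor on commutative squares. -/
noncomputable abbrev Rmap {f g : Arrow C} (s : f ⟶ g) :
    Arrow.mk (𝓕.rho f) ⟶ Arrow.mk (𝓕.rho g) :=
  Arrow.homMk (𝓕.Kmap s) s.right (𝓕.Kmap_rho s).symm

lemma mapHom_L {f g : Arrow C} (s : f ⟶ g) : mapHom 𝓕.L s = 𝓕.Lmap s :=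
  Arrow.hom_ext _ _ ((mapHom_toArrow_left _ _ _ _ s).trans (mapHom_domFunctor s))
    (mapHom_toArrow_right _ _ _ _ s)

lemma mapHom_R {f g : Arrow C} (s : f ⟶ g) : mapHom 𝓕.R s = 𝓕.Rmap s :=
  Arrow.hom_ext _ _ (mapHom_toArrow_left _ _ _ _ s)
    ((mapHom_toArrow_right _ _ _ _ s).trans (mapHom_codFunctor s))

end FunctorialFactorisation

namespace AWFS

variable (𝓐 : AWFS V C)

lemma Kmap_sigma {f g : Arrow C} (s : f ⟶ g) :
    𝓐.Kmap s ≫ 𝓐.sigma g = 𝓐.sigma f ≫ 𝓐.Kmap (𝓐.Lmap s) :=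
  mapHom_natural' 𝓐.K (𝓐.L.comp V 𝓐.K) 𝓐.sigma 𝓐.sigma_natural s _ (by
    rw [← 𝓐.mapHom_L]
    exact ((eHomEquiv_mapHom (𝓐.L.comp V 𝓐.K) s).symm.trans
      (congrArg _ (mapHom_functor_comp 𝓐.L 𝓐.K s))))

lemma Kmap_Rmap_pi {f g : Arrow C} (s : f ⟶ g) :
    𝓐.Kmap (𝓐.Rmap s) ≫ 𝓐.pi g = 𝓐.pi f ≫ 𝓐.Kmap s := by
  rw [← 𝓐.mapHom_R]
  exact (congrArg (· ≫ 𝓐.pi g) (mapHom_functor_comp 𝓐.R 𝓐.K s)).symm.trans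
    (mapHom_natural' (𝓐.R.comp V 𝓐.K) 𝓐.K 𝓐.pi 𝓐.pi_natural s _ (eHomEquiv_mapHom _ _).symm)

/-- Stacked algebra morphisms form a morphism of composite algebras. Naturality of $\sigma$ and the
hypothesis on `s` reduce this to an equality of two squares into `f'`: their domain parts agree by
`hrs`, and their codomain parts by `ht`. -/
lemma Kmap_compStr {X Y Z X' Y' Z' : C} {f : X ⟶ Y} {g : Y ⟶ Z} {k : X ⟶ Z} (hk : f ≫ g = k)
    {f' : X' ⟶ Y'} {g' : Y' ⟶ Z'} {k' : X' ⟶ Z'} (hk' : f' ≫ g' = k')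
    {p : 𝓐.K.obj (Arrow.mk f) ⟶ X} {q : 𝓐.K.obj (Arrow.mk g) ⟶ Y}
    (hq : 𝓐.lam (Arrow.mk g) ≫ q = 𝟙 Y)
    {p' : 𝓐.K.obj (Arrow.mk f') ⟶ X'} {q' : 𝓐.K.obj (Arrow.mk g') ⟶ Y'}
    (hq' : 𝓐.lam (Arrow.mk g') ≫ q' = 𝟙 Y')
    (s : Arrow.mk f ⟶ Arrow.mk f') (t : Arrow.mk g ⟶ Arrow.mk g') (r : Arrow.mk k ⟶ Arrow.mk k')
    (hst : s.right = t.left) (hrs : r.left = s.left) (hrt : r.right = t.right)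
    (hs : 𝓐.Kmap s ≫ p' = p ≫ s.left) (ht : 𝓐.Kmap t ≫ q' = q ≫ t.left) :
    𝓐.Kmap r ≫ 𝓐.compStr f' g' k' hk' p' q' hq' = 𝓐.compStr f g k hk p q hq ≫ s.left := by
  have hsw : s.left ≫ f' = f ≫ t.left := by rw [← hst]; exact s.w
  rw [compStr, compStr, reassoc_of% (𝓐.Kmap_sigma r), ← reassoc_of% (𝓐.Kmap_comp), Category.assoc,
    Category.assoc, ← hs, ← reassoc_of% (𝓐.Kmap_comp)]
  congr 3
  refine Arrow.hom_ext _ _ ?_ ?_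
  · simp [hrs]
  · simp only [Arrow.comp_right, Arrow.homMk_right, hst, Category.assoc]
    rw [← ht, ← reassoc_of% (𝓐.Kmap_comp), ← reassoc_of% (𝓐.Kmap_comp)]
    congr 2
    exact Arrow.hom_ext _ _ (by simp [hrs, hsw]) (by simp [hrt])

variable {𝓐} in
/-- A structure map on which a jointly epimorphic family of algebras maps is an algebra. -/
lemma IsAlg.of_jointly_epi {I : Type*} {g : Arrow C} {G : I → Arrow C} (s : ∀ d, G d ⟶ g)
    {q : ∀ d, 𝓐.K.obj (G d) ⟶ (G d).left} (hq : ∀ d, 𝓐.IsAlg (G d) (q d))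
    {p : 𝓐.K.obj g ⟶ g.left} (hp : ∀ d, 𝓐.Kmap (s d) ≫ p = q d ≫ (s d).left)
    (h₁ : ∀ (a b : g.left ⟶ g.left), (∀ d, (s d).left ≫ a = (s d).left ≫ b) → a = b)
    (h₂ : ∀ (a b : 𝓐.K.obj g ⟶ g.right), (∀ d, 𝓐.Kmap (s d) ≫ a = 𝓐.Kmap (s d) ≫ b) → a = b)
    (h₃ : ∀ (a b : 𝓐.K.obj (Arrow.mk (𝓐.rho g)) ⟶ g.left),
      (∀ d, 𝓐.Kmap (𝓐.Rmap (s d)) ≫ a = 𝓐.Kmap (𝓐.Rmap (s d)) ≫ b) → a = b) :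
    𝓐.IsAlg g p := by
  -- Proved before the other laws because the associativity law is only well formed once $(p,1)$ is
  -- a square $\rho_g\to g$.
  have hom : p ≫ g.hom = 𝓐.rho g := h₂ _ _ fun d => by
    rw [reassoc_of% hp d, ← 𝓐.Kmap_rho, Arrow.w, ← (hq d).comp_hom, Category.assoc]
  -- The unit law equates endomorphisms of $\mathrm{dom}\,g$ and the associativity law equates maps
  -- out of $K\rho_g$, so each is tested on its own family.
  refine ⟨hom, h₁ _ _ fun d => ?_, h₃ _ _ fun d => ?_⟩
  · rw [← Category.assoc, ← 𝓐.lam_Kmap, Category.assoc, hp, ← Category.assoc, (hq d).unit,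
      Category.id_comp, Category.comp_id]
  · rw [reassoc_of% (𝓐.Kmap_Rmap_pi (s d)), hp, ← Category.assoc (𝓐.pi _), ← (hq d).assoc,
      Category.assoc, ← hp, ← reassoc_of% (𝓐.Kmap_comp), ← reassoc_of% (𝓐.Kmap_comp)]
    congr 2
    exact Arrow.hom_ext _ _ (by simp [hp]) (by simp)

end AWFS

end AWFS

/-! ### Functoriality of pulled-back algebras. -/

section Pulled

variable {V : Type u₁} [Category.{v₁} V] [MonoidalCategory V] [HasPullbacks V]
variable {C : Type u₂} [Category.{v₂} C] [EnrichedOrdinaryCategory V C]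
variable {A B D : C} (g : A ⟶ B) (h : B ⟶ D) (k : A ⟶ D) (hk : g ≫ h = k)

lemma eHomWhiskerLeft_arrowPre {f f' : Arrow C} (s : f ⟶ f') :
    eHomWhiskerLeft V (Arrow.mk h) s ≫ arrowPre V g h k hk f' =
      arrowPre V g h k hk f ≫ eHomWhiskerLeft V (Arrow.mk k) s := by
  apply arrowHom_ext
  · rw [Category.assoc, Category.assoc, eHomWhiskerLeft_arrowFst, arrowPre, arrowPre,
      arrowLift_fst, reassoc_of% (arrowLift_fst V), reassoc_of% (eHomWhiskerLeft_arrowFst V),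
      Category.assoc]
    exact congrArg _ (eHom_whisker_exchange V g s.left)
  · rw [Category.assoc, Category.assoc, eHomWhiskerLeft_arrowSnd, arrowPre, arrowPre,
      arrowLift_snd, reassoc_of% (arrowLift_snd V), eHomWhiskerLeft_arrowSnd]
    rfl

lemma eHomWhiskerLeft_arrowSub {f f' : Arrow C} (s : f ⟶ f') :
    eHomWhiskerLeft V (Arrow.mk k) s ≫ arrowSub V g h k hk f' =
      arrowSub V g h k hk f ≫ eHomWhiskerLeft V (Arrow.mk g) s := by
  apply arrowHom_ext
  · rw [Category.assoc, Category.assoc, eHomWhiskerLeft_arrowFst, arrowSub, arrowSub,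
      arrowLift_fst, reassoc_of% (arrowLift_fst V), eHomWhiskerLeft_arrowFst]
    rfl
  · rw [Category.assoc, Category.assoc, eHomWhiskerLeft_arrowSnd, arrowSub, arrowSub,
      arrowLift_snd, reassoc_of% (arrowLift_snd V), reassoc_of% (eHomWhiskerLeft_arrowSnd V),
      Category.assoc]
    exact congrArg _ (eHom_whisker_exchange V h s.right)

/-- The action of `f` on the arrow `C^2(h, f) ⟶ C^2(k, f)`. -/
noncomputable abbrev preMap {f f' : Arrow C} (s : f ⟶ f') :
    Arrow.mk (arrowPre V g h k hk f) ⟶ Arrow.mk (arrowPre V g h k hk f') :=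
  Arrow.homMk (eHomWhiskerLeft V (Arrow.mk h) s) (eHomWhiskerLeft V (Arrow.mk k) s)
    (eHomWhiskerLeft_arrowPre g h k hk s)

/-- Tested on the two projections of $\mathcal C^{\mathbf 2}(h,f')$: the first reduces to `hs`,
through the naturality in `f` of the pullback square, and the second to the naturality of $\rho$. -/
lemma Kmap_pulledStr [MonoidalClosed V] (𝓜 : AWFS V V) {f f' : Arrow C} (s : f ⟶ f')
    {p : 𝓜.K.obj (Arrow.mk (arrowDiag V (Arrow.mk g) f)) ⟶ (B ⟶[V] f.left)}
    {p' : 𝓜.K.obj (Arrow.mk (arrowDiag V (Arrow.mk g) f')) ⟶ (B ⟶[V] f'.left)}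
    (hp : 𝓜.IsAlg (Arrow.mk (arrowDiag V (Arrow.mk g) f)) p)
    (hp' : 𝓜.IsAlg (Arrow.mk (arrowDiag V (Arrow.mk g) f')) p')
    (hs : 𝓜.Kmap (mapHom (diagCov V (Arrow.mk g)) s) ≫ p' = p ≫ eHomWhiskerLeft V B s.left) :
    𝓜.Kmap (preMap g h k hk s) ≫ pulledStr 𝓜 g h k hk f' p' hp' =
      pulledStr 𝓜 g h k hk f p hp ≫ eHomWhiskerLeft V (Arrow.mk h) s := by
  apply arrowHom_ext
  · rw [Category.assoc, Category.assoc, eHomWhiskerLeft_arrowFst, pulledStr, pulledStr,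
      arrowLift_fst, reassoc_of% (arrowLift_fst V), Category.assoc]
    refine Eq.trans ?_ (congrArg _ hs)
    rw [← reassoc_of% (𝓜.Kmap_comp)]
    refine Eq.trans ?_ ((congrArg (· ≫ p') (𝓜.Kmap_comp _ _)).trans (Category.assoc _ _ _))
    refine congrArg (𝓜.Kmap · ≫ p') (Arrow.hom_ext _ _ ?_ ?_)
    · refine (eHomWhiskerLeft_arrowFst V _ _).trans ?_
      exact congrArg _ (mapHom_diagCov_left (V := V) (Arrow.mk g) s).symm
    · refine (eHomWhiskerLeft_arrowSub g h k hk s).trans ?_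
      exact congrArg _ (mapHom_diagCov_right (V := V) (Arrow.mk g) s).symm
  · rw [Category.assoc, Category.assoc, eHomWhiskerLeft_arrowSnd, pulledStr, pulledStr,
      arrowLift_snd, reassoc_of% (arrowLift_snd V), Category.assoc, ← Category.assoc, ← 𝓜.Kmap_rho,
      Category.assoc]
    exact congrArg _ (eHomWhiskerLeft_arrowSnd V (Arrow.mk k) s)

end Pulled

/-! ### Conical colimits, and their componentwise computation in the arrow category. -/

section Conical

variable {V : Type u₁} [Category.{v₁} V] [MonoidalCategory V]
variable {C : Type u₂} [Category.{v₂} C] [EnrichedOrdinaryCategory V C]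
variable {𝒟 : Type u₃} [Category.{v₃} 𝒟]

/-- The limit condition in terms of generalised elements `T ⟶ (c.pt ⟶[V] Y)`, which avoids cones
over opposite categories in later arguments. -/
lemma isConicalColimit_iff {F : 𝒟 ⥤ C} (c : Cocone F) :
    IsConicalColimit V c ↔ ∀ (Y : C) (T : V) (a : ∀ d, T ⟶ (F.obj d ⟶[V] Y)),
      (∀ ⦃d d' : 𝒟⦄ (φ : d ⟶ d'), a d' ≫ eHomWhiskerRight V (F.map φ) Y = a d) →
      ∃! l : T ⟶ (c.pt ⟶[V] Y), ∀ d, l ≫ eHomWhiskerRight V (c.ι.app d) Y = a d := by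
  refine ⟨fun h Y T a ha => ?_, fun h Y => ?_⟩
  · let s : Cone (F.op ⋙ (eHomFunctor V C).flip.obj Y) :=
      { pt := T
        π := { app := fun d => a d.unop
               naturality := fun d d' φ => (Category.id_comp _).trans (ha φ.unop).symm } }
    obtain ⟨hl⟩ := h Y
    exact ⟨hl.lift s, fun d => hl.fac s (op d), fun m hm => hl.uniq s m fun d => hm d.unop⟩
  · choose l hl hl' using fun s : Cone (F.op ⋙ (eHomFunctor V C).flip.obj Y) =>
      h Y s.pt (fun d => s.π.app (op d)) fun _ _ φ => s.w φ.op
    exact ⟨{ lift := l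
             fac := fun s d => hl s d.unop
             uniq := fun s m hm => hl' s m fun d => hm (op d) }⟩

lemma IsConicalColimit.nonempty_isColimit {F : 𝒟 ⥤ C} {c : Cocone F}
    (h : IsConicalColimit V c) : Nonempty (IsColimit c) := by
  rw [isConicalColimit_iff] at h
  choose l hl hl' using fun s : Cocone F =>
    h s.pt (𝟙_ V) (fun d => eHomEquiv V (s.ι.app d)) fun _ _ φ => by
      rw [eHomEquiv_whiskerRight, s.w]
  refine ⟨{ desc := fun s => (eHomEquiv V).symm (l s), fac := fun s d => ?_,
            uniq := fun s m hm => ?_ }⟩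
  · apply (eHomEquiv V).injective
    rw [← eHomEquiv_whiskerRight, Equiv.apply_symm_apply]
    exact hl s d
  · rw [Equiv.eq_symm_apply]
    refine hl' s _ fun d => ?_
    rw [← hm d]
    exact eHomEquiv_whiskerRight V _ _

/-- A conical colimit is an ordinary one, so `c` and `c₀` are isomorphic. Hence, where conical
colimits exist, every ordinary colimit is conical. -/
lemma IsConicalColimit.of_isColimit {F : 𝒟 ⥤ C} {c₀ c : Cocone F} (h : IsConicalColimit V c₀)
    (hc : IsColimit c) : IsConicalColimit V c := by
  obtain ⟨h₀⟩ := h.nonempty_isColimit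
  rw [isConicalColimit_iff] at h ⊢
  intro Y T a ha
  let e := hc.coconePointUniqueUpToIso h₀
  have he (d : 𝒟) : c.ι.app d ≫ e.hom = c₀.ι.app d :=
    hc.comp_coconePointUniqueUpToIso_hom h₀ d
  have he' (d : 𝒟) : c₀.ι.app d ≫ e.inv = c.ι.app d :=
    hc.comp_coconePointUniqueUpToIso_inv h₀ d
  obtain ⟨l, hl, hl'⟩ := h Y T a ha
  refine ⟨l ≫ eHomWhiskerRight V e.hom Y, fun d => ?_, fun m hm => ?_⟩
  · rw [Category.assoc, ← eHomWhiskerRight_comp, he, hl]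
  · dsimp only at hm
    rw [← hl' (m ≫ eHomWhiskerRight V e.inv Y) fun d => by
      rw [Category.assoc, ← eHomWhiskerRight_comp, he', hm], Category.assoc,
      ← eHomWhiskerRight_comp, e.hom_inv_id, eHomWhiskerRight_id, Category.comp_id]

lemma IsConicalColimit.arrow [HasPullbacks V] {F : 𝒟 ⥤ Arrow C} {c : Cocone F}
    (hl : IsConicalColimit V (Arrow.leftFunc.mapCocone c))
    (hr : IsConicalColimit V (Arrow.rightFunc.mapCocone c)) : IsConicalColimit V c := by
  rw [isConicalColimit_iff] at hl hr ⊢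
  replace hl : ∀ (Y : C) (T : V) (a : ∀ d, T ⟶ ((F.obj d).left ⟶[V] Y)),
      (∀ ⦃d d' : 𝒟⦄ (φ : d ⟶ d'), a d' ≫ eHomWhiskerRight V (F.map φ).left Y = a d) →
      ∃! l : T ⟶ (c.pt.left ⟶[V] Y), ∀ d, l ≫ eHomWhiskerRight V (c.ι.app d).left Y = a d := hl
  replace hr : ∀ (Y : C) (T : V) (a : ∀ d, T ⟶ ((F.obj d).right ⟶[V] Y)),
      (∀ ⦃d d' : 𝒟⦄ (φ : d ⟶ d'), a d' ≫ eHomWhiskerRight V (F.map φ).right Y = a d) →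
      ∃! l : T ⟶ (c.pt.right ⟶[V] Y), ∀ d, l ≫ eHomWhiskerRight V (c.ι.app d).right Y = a d := hr
  intro Y T a ha
  change ∀ d, T ⟶ arrowHom V (F.obj d) Y at a
  obtain ⟨x, hx, hx'⟩ := hl Y.left T (fun d => a d ≫ arrowFst V (F.obj d) Y) fun d d' φ => by
    rw [← ha φ, Category.assoc, Category.assoc]
    exact congrArg _ (eHomWhiskerRight_arrowFst V (F.map φ) Y).symm
  obtain ⟨y, hy, hy'⟩ := hr Y.right T (fun d => a d ≫ arrowSnd V (F.obj d) Y) fun d d' φ => by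
    rw [← ha φ, Category.assoc, Category.assoc]
    exact congrArg _ (eHomWhiskerRight_arrowSnd V (F.map φ) Y).symm
  dsimp only at hx hx' hy hy'
  have el (d : 𝒟) : eHomWhiskerRight V (c.ι.app d) Y ≫ arrowFst V (F.obj d) Y =
      arrowFst V c.pt Y ≫ eHomWhiskerRight V (c.ι.app d).left Y.left :=
    eHomWhiskerRight_arrowFst V (c.ι.app d) Y
  have er (d : 𝒟) : eHomWhiskerRight V (c.ι.app d) Y ≫ arrowSnd V (F.obj d) Y =
      arrowSnd V c.pt Y ≫ eHomWhiskerRight V (c.ι.app d).right Y.right :=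
    eHomWhiskerRight_arrowSnd V (c.ι.app d) Y
  -- Both sides are elements of $\mathcal C(\mathrm{dom}\,c,\mathrm{cod}\,Y)$, so by the uniqueness
  -- in `hl` they may be compared after restriction along each leg, where they agree because `a d`
  -- is a compatible pair.
  have hxy : x ≫ eHomWhiskerLeft V c.pt.left Y.hom = y ≫ eHomWhiskerRight V c.pt.hom Y.right := by
    refine (hl Y.right T (fun d => x ≫ eHomWhiskerLeft V c.pt.left Y.hom ≫
      eHomWhiskerRight V (c.ι.app d).left Y.right) fun d d' φ => ?_).unique
        (fun d => Category.assoc _ _ _) fun d => ?_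
    · rw [Category.assoc, Category.assoc, ← eHomWhiskerRight_comp, ← Arrow.comp_left, c.w]
    · have hw : (c.ι.app d).left ≫ c.pt.hom = _ := Arrow.w (c.ι.app d)
      rw [Category.assoc, ← eHomWhiskerRight_comp, hw, eHomWhiskerRight_comp, reassoc_of% hy,
        eHom_whisker_exchange, reassoc_of% hx,
        arrow_condition]
  refine ⟨arrowLift V x y hxy, fun d => arrowHom_ext V ?_ ?_, fun m hm => arrowHom_ext V ?_ ?_⟩
  · rw [Category.assoc, el, ← Category.assoc, arrowLift_fst, hx]
  · rw [Category.assoc, er, ← Category.assoc, arrowLift_snd, hy]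
  · rw [arrowLift_fst]
    refine hx' _ fun d => ?_
    refine (Category.assoc _ _ _).trans ((congrArg (m ≫ ·) (el d).symm).trans ?_)
    exact (Category.assoc _ _ _).symm.trans (congrArg (· ≫ arrowFst V (F.obj d) Y) (hm d))
  · rw [arrowLift_snd]
    refine hy' _ fun d => ?_
    refine (Category.assoc _ _ _).trans ((congrArg (m ≫ ·) (er d).symm).trans ?_)
    exact (Category.assoc _ _ _).symm.trans (congrArg (· ≫ arrowSnd V (F.obj d) Y) (hm d))

end Conical

/-! ### Conical colimits in inserters. -/

section Inserter

variable {V : Type u₁} [Category.{v₁} V] [MonoidalCategory V]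
variable {D : Type u₂} [Category.{v₂} D] [EnrichedOrdinaryCategory V D]
variable {E : Type u₃} [Category.{v₃} E] [EnrichedOrdinaryCategory V E]
variable {I : Type w} {F G : I → EnrichedFunctor V D E} [HasEqualizers V] [HasProductsOfShape I V]

namespace Inserter

lemma eHomWhiskerRight_homIncl {x x' : Inserter F G} (s : x ⟶ x') (y : Inserter F G) :
    eHomWhiskerRight V s y ≫ homIncl x y = homIncl x' y ≫ eHomWhiskerRight V s.hom y.obj := by
  have h1 : eHomEquiv V s ≫ homIncl x x' = eHomEquiv V s.hom := homEquiv_incl s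
  have h2 : eComp V x x' y ≫ homIncl x y = (homIncl x x' ⊗ₘ homIncl x' y) ≫ eComp V _ _ _ :=
    homComp_incl x x' y
  simp only [eHomWhiskerRight, Category.assoc]
  rw [h2, ← h1, ← tensorHom_id, ← tensorHom_id, tensorHom_comp_tensorHom_assoc,
    leftUnitor_inv_naturality_assoc]
  rw [← id_tensorHom, tensorHom_comp_tensorHom_assoc]
  simp only [Category.id_comp, Category.comp_id]
  rfl

/-- A cocone in a full subcategory of an inserter is a conical colimit when its image in `D` is
one and the functors `F i` send its image to a family that is jointly epimorphic in the enriched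
sense. -/
lemma isConicalColimit_fullSubcategory {Q : ObjectProperty (Inserter F G)} {𝒟 : Type u₄}
    [Category.{v₄} 𝒟] {X : 𝒟 ⥤ Q.FullSubcategory} {c : Cocone X}
    (hc : IsConicalColimit V ((Q.ι ⋙ forget F G).mapCocone c))
    (hF : ∀ (i : I) (T : V) (Z : E) (a b : T ⟶ ((F i).obj c.pt.obj.obj ⟶[V] Z)),
      (∀ d, a ≫ eHomWhiskerRight V (mapHom (F i) (c.ι.app d).hom.hom) Z =
        b ≫ eHomWhiskerRight V (mapHom (F i) (c.ι.app d).hom.hom) Z) → a = b) :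
    IsConicalColimit V c := by
  rw [isConicalColimit_iff] at hc ⊢
  replace hc : ∀ (Y : D) (T : V) (a : ∀ d, T ⟶ ((X.obj d).obj.obj ⟶[V] Y)),
      (∀ ⦃d d' : 𝒟⦄ (φ : d ⟶ d'), a d' ≫ eHomWhiskerRight V (X.map φ).hom.hom Y = a d) →
      ∃! l : T ⟶ (c.pt.obj.obj ⟶[V] Y),
        ∀ d, l ≫ eHomWhiskerRight V (c.ι.app d).hom.hom Y = a d := hc
  intro Y T a ha
  change ∀ d, T ⟶ homObj (X.obj d).obj Y.obj at a
  have ha {d d' : 𝒟} (φ : d ⟶ d') : a d' ≫ eHomWhiskerRight V (X.map φ).hom Y.obj = a d := ha φ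
  obtain ⟨l, hl, hl'⟩ := hc Y.obj.obj T (fun d => a d ≫ homIncl (X.obj d).obj Y.obj)
    fun d d' φ => by
      rw [← ha φ, Category.assoc, Category.assoc]
      exact congrArg _ (eHomWhiskerRight_homIncl _ _).symm
  dsimp only at hl hl'
  have ei (d : 𝒟) : eHomWhiskerRight V (c.ι.app d) Y ≫ homIncl (X.obj d).obj Y.obj =
      homIncl c.pt.obj Y.obj ≫ eHomWhiskerRight V (c.ι.app d).hom.hom Y.obj.obj :=
    eHomWhiskerRight_homIncl (c.ι.app d).hom Y.obj
  -- The only point beyond the universal property in `D` is that the induced `l` lands in the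
  -- equaliser. Restricted along $F_i$ of a leg, which commutes with the structures, this becomes
  -- the equaliser condition for `a d`.
  have hcomm : Commutes (x := c.pt.obj) (y := Y.obj) l := fun i => hF i _ _ _ _ fun d => by
    have hs : mapHom (F i) (c.ι.app d).hom.hom ≫ c.pt.obj.str i =
        (X.obj d).obj.str i ≫ mapHom (G i) (c.ι.app d).hom.hom := (c.ι.app d).hom.comm i
    have h1 := map_eHomWhiskerRight (F i) (c.ι.app d).hom.hom Y.obj.obj
    have h2 := map_eHomWhiskerRight (G i) (c.ι.app d).hom.hom Y.obj.obj
    dsimp only [Functor.const_obj_obj] at h1 h2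
    rw [Category.assoc, Category.assoc, Category.assoc, Category.assoc, eHom_whisker_exchange,
      ← eHomWhiskerRight_comp, hs, eHomWhiskerRight_comp, reassoc_of% h1, reassoc_of% h2,
      reassoc_of% (hl d), reassoc_of% (hl d)]
    have := congrArg (a d ≫ ·) (commutes_homIncl (X.obj d).obj Y.obj i)
    simpa only [Category.assoc] using this
  refine ⟨homLift l hcomm, fun d => homObj_ext ?_, fun m hm => homObj_ext ?_⟩
  · rw [Category.assoc, ei, ← Category.assoc, homLift_incl, hl]
  · rw [homLift_incl]
    refine hl' _ fun d => ?_
    refine (Category.assoc _ _ _).trans ((congrArg (m ≫ ·) (ei d).symm).trans ?_)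
    exact (Category.assoc _ _ _).symm.trans
      (congrArg (· ≫ homIncl (X.obj d).obj Y.obj) (hm d))

end Inserter

end Inserter

/-! ### Joint epimorphicity in the enriched sense. -/

section Closed

variable {V : Type u₁} [Category.{v₁} V] [MonoidalCategory V] [MonoidalClosed V]
  [BraidedCategory V]

/-- Jointly epimorphic families in a monoidal closed category are so in the enriched sense. -/
lemma eHomWhiskerRight_jointly_mono {I : Type*} {K : I → V} {K' : V} (s : ∀ d, K d ⟶ K')
    (h : ∀ (Z : V) (a b : K' ⟶ Z), (∀ d, s d ≫ a = s d ≫ b) → a = b) {T Z : V}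
    (a b : T ⟶ (ihom K').obj Z)
    (hab : ∀ d, a ≫ eHomWhiskerRight V (s d) Z = b ≫ eHomWhiskerRight V (s d) Z) : a = b := by
  -- Maps $T\to[K',Z]$ correspond, through the braiding, to maps $K'\to[T,Z]$. Restriction along `s
  -- d` becomes precomposition, so `h` applies with target $[T,Z]$.
  apply MonoidalClosed.uncurry_injective
  rw [← cancel_epi (β_ T K').hom]
  apply MonoidalClosed.curry_injective
  refine h _ _ _ fun d => ?_
  rw [← MonoidalClosed.curry_natural_left, ← MonoidalClosed.curry_natural_left,
    BraidedCategory.braiding_naturality_right_assoc,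
    BraidedCategory.braiding_naturality_right_assoc]
  have := hab d
  rw [MonoidalClosed.enrichedOrdinaryCategorySelf_eHomWhiskerRight] at this
  have := congrArg MonoidalClosed.uncurry this
  have e (a : T ⟶ (ihom K').obj Z) : s d ▷ T ≫ MonoidalClosed.uncurry a =
      MonoidalClosed.uncurry (a ≫ (MonoidalClosed.pre (s d)).app Z) :=
    (MonoidalClosed.uncurry_pre_app (A := K') (B := K d) (X := Z) a (s d)).symm
  rw [e, e]
  exact congrArg _ (congrArg _ this)

end Closed

/-- `V`-naturality is inherited along a family of `V`-natural transformations whose components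
are jointly epimorphic in the enriched sense. -/
lemma IsVNatural.of_jointly_epi {V : Type u₁} [Category.{v₁} V] [MonoidalCategory V]
    {B : Type u₂} [EnrichedCategory V B] {E : Type u₃} [Category.{v₃} E]
    [EnrichedOrdinaryCategory V E] {I : Type*} {F G : EnrichedFunctor V B E}
    {F' G' : I → EnrichedFunctor V B E} {τ : ∀ b, F.obj b ⟶ G.obj b}
    {τ' : ∀ d b, (F' d).obj b ⟶ (G' d).obj b} {α : ∀ d b, (F' d).obj b ⟶ F.obj b}
    {β : ∀ d b, (G' d).obj b ⟶ G.obj b} (hτ' : ∀ d, IsVNatural V (F' d) (G' d) (τ' d))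
    (hα : ∀ d, IsVNatural V (F' d) F (α d)) (hβ : ∀ d, IsVNatural V (G' d) G (β d))
    (h : ∀ d b, α d b ≫ τ b = τ' d b ≫ β d b)
    (hm : ∀ b (T : V) (Z : E) (x y : T ⟶ (F.obj b ⟶[V] Z)),
      (∀ d, x ≫ eHomWhiskerRight V (α d b) Z = y ≫ eHomWhiskerRight V (α d b) Z) → x = y) :
    IsVNatural V F G τ := fun b b' => hm b _ _ _ _ fun d => by
  -- After restriction along `α d b`, naturality of `α d` and `β d` and the squares `h` turn both
  -- sides into those of the naturality of `τ' d`, followed by `β d b'`.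
  rw [Category.assoc, Category.assoc, eHom_whisker_exchange, ← eHomWhiskerRight_comp, h,
    ← reassoc_of% (hα d b b'), ← eHomWhiskerLeft_comp, h, eHomWhiskerLeft_comp,
    reassoc_of% (hτ' d b b'), ← eHom_whisker_exchange, reassoc_of% (hβ d b b'),
    eHomWhiskerRight_comp]

/-! ### Inheritance of structured liftings. -/

section Pitchfork

variable {V : Type u₁} [Category.{v₁} V] [MonoidalCategory V] [MonoidalClosed V] [HasPullbacks V]
variable {C : Type u₂} [Category.{v₂} C] [EnrichedOrdinaryCategory V C]
variable {J : InternalCat.{v₁, u₁, w} V} (𝓜 : AWFS V V) (U : J.ToSq C)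

/-- The action of `f` on the arrow `C(cod U i, dom f) ⟶ C^2(U i, f)`. -/
noncomputable abbrev wMap (i : J.Arr) {f f' : Arrow C} (s : f ⟶ f') : wArr U i f ⟶ wArr U i f' :=
  mapHom (diagCov V (U.arrFunctor.obj i)) s

lemma mapHom_srcStr (i : J.Arr) {f f' : Arrow C} (s : f ⟶ f') :
    mapHom (srcStr 𝓜 U i) s = 𝓜.Kmap (wMap U i s) := mapHom_functor_comp _ _ s

lemma mapHom_tgtStr (i : J.Arr) {f f' : Arrow C} (s : f ⟶ f') :
    mapHom (tgtStr (V := V) U i) s = (wMap U i s).left :=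
  (mapHom_functor_comp (domFunctor V C) (covHom (U.arrFunctor.obj i).right) s).trans
    ((congrArg _ (mapHom_domFunctor s)).trans ((mapHom_covHom _ _).trans
      (mapHom_diagCov_left (V := V) (U.arrFunctor.obj i) s).symm))

-- The inserter condition read as the statement that $W_i(s)$ is a morphism of algebras, the form in
-- which the lemmas on algebras use it.
variable {𝓜 U} in
lemma Inserter.Hom.Kmap_wMap {x y : Inserter (srcStr 𝓜 U) (tgtStr (V := V) U)} (s : x ⟶ y)
    (i : J.Arr) : 𝓜.Kmap (wMap U i s.hom) ≫ y.str i = x.str i ≫ (wMap U i s.hom).left := by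
  have h := s.comm i
  rw [mapHom_srcStr, mapHom_tgtStr] at h
  exact h

variable [BraidedCategory V]

lemma isVNatural_srcPresheaf {f f' : Arrow C} (s : f ⟶ f') :
    IsVNatural V (srcPresheaf 𝓜 U f) (srcPresheaf 𝓜 U f')
      fun i => 𝓜.Kmap (wMap U i.unop s) :=
  ((isVNatural_diagContra s).functor_comp (opFunctor U.arrFunctor)).comp_functor 𝓜.K

lemma isVNatural_tgtPresheaf {f f' : Arrow C} (s : f ⟶ f') :
    IsVNatural V (tgtPresheaf (V := V) U f) (tgtPresheaf U f')
      fun i => (wMap U i.unop s).left :=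
  ((isVNatural_contraHom s.left).functor_comp
    ((opFunctor U.arrFunctor).comp V (opFunctor (codFunctor V C)))).congr
      fun i => (mapHom_diagCov_left (V := V) (U.arrFunctor.obj i.unop) s).symm

variable {𝓜 U}

/-- Structured liftings are inherited along a family of morphisms that is jointly epimorphic
after the application of the functors involved. -/
lemma IsPitchfork.of_jointly_epi {I : Type*} {x : Inserter (srcStr 𝓜 U) (tgtStr (V := V) U)}
    {X : I → Inserter (srcStr 𝓜 U) (tgtStr (V := V) U)} (hX : ∀ d, IsPitchfork 𝓜 U (X d))
    (s : ∀ d, X d ⟶ x)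
    (h₁ : ∀ (i : J.Arr) (Z : V) (a b : (wArr U i x.obj).left ⟶ Z),
      (∀ d, (wMap U i (s d).hom).left ≫ a = (wMap U i (s d).hom).left ≫ b) → a = b)
    (h₂ : ∀ (i : J.Arr) (Z : V) (a b : 𝓜.K.obj (wArr U i x.obj) ⟶ Z),
      (∀ d, 𝓜.Kmap (wMap U i (s d).hom) ≫ a = 𝓜.Kmap (wMap U i (s d).hom) ≫ b) → a = b)
    (h₃ : ∀ (i : J.Arr) (Z : V) (a b : 𝓜.K.obj (Arrow.mk (𝓜.rho (wArr U i x.obj))) ⟶ Z),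
      (∀ d, 𝓜.Kmap (𝓜.Rmap (wMap U i (s d).hom)) ≫ a =
        𝓜.Kmap (𝓜.Rmap (wMap U i (s d).hom)) ≫ b) → a = b) :
    IsPitchfork 𝓜 U x := by
  have alg (i : J.Arr) : 𝓜.IsAlg (wArr U i x.obj) (x.str i) :=
    AWFS.IsAlg.of_jointly_epi (fun d => wMap U i (s d).hom) (fun d => (hX d).alg i)
      (fun d => (s d).Kmap_wMap i) (h₁ i _) (h₂ i _) (h₃ i _)
  refine ⟨alg, ?_, fun {a b e} i j => ?_⟩
  · exact IsVNatural.of_jointly_epi (fun d => (hX d).natural)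
      (fun d => isVNatural_srcPresheaf 𝓜 U (s d).hom) (fun d => isVNatural_tgtPresheaf U (s d).hom)
      (fun d i => (s d).Kmap_wMap i.unop)
      (fun i _ _ _ _ hab => eHomWhiskerRight_jointly_mono _ (h₂ i.unop) _ _ hab)
  -- Both candidate structures at the composite are compatible with the legs: the given one because
  -- the legs are morphisms of the inserter, the composite one because pullback and composition of
  -- algebras are functorial. As the law holds for each `X d`, the two agree after restriction.
  · refine h₂ (J.ar (J.vcomp i j)) _ _ _ fun d => ?_
    refine ((s d).Kmap_wMap _).trans ?_
    rw [(hX d).comp i j]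
    -- The composite $j\bullet i$ and $j$ have the same target, so this formula identifies the
    -- domain parts of their actions, which are both postcomposition on $\mathcal
    -- C(\mathrm{cod}\,Uj,-)$.
    have hl (k : J.Arr) : (wMap U k (s d).hom).left = _ :=
      mapHom_diagCov_left (V := V) (U.arrFunctor.obj k) (s d).hom
    have hr (k : J.Arr) : (wMap U k (s d).hom).right = _ :=
      mapHom_diagCov_right (V := V) (U.arrFunctor.obj k) (s d).hom
    have key := 𝓜.Kmap_compStr
      (arrowDiag_pre V (U.arrMap i) (U.arrMap j) (U.arrMap (J.vcomp i j))
        (U.arrMap_vcomp i j).symm (X d).obj)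
      (arrowDiag_pre V (U.arrMap i) (U.arrMap j) (U.arrMap (J.vcomp i j))
        (U.arrMap_vcomp i j).symm x.obj)
      (lam_pulledStr 𝓜 _ _ _ (U.arrMap_vcomp i j).symm (X d).obj _ ((hX d).alg (J.ar i)))
      (lam_pulledStr 𝓜 _ _ _ (U.arrMap_vcomp i j).symm x.obj _ (alg (J.ar i)))
      (wMap U (J.ar j) (s d).hom)
      (preMap (U.arrMap i) (U.arrMap j) (U.arrMap (J.vcomp i j))
        (U.arrMap_vcomp i j).symm (s d).hom)
      (wMap U (J.ar (J.vcomp i j)) (s d).hom) (hr (J.ar j))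
      ((hl (J.ar (J.vcomp i j))).trans (hl (J.ar j)).symm) (hr (J.ar (J.vcomp i j)))
      ((s d).Kmap_wMap _) (Kmap_pulledStr (U.arrMap i) (U.arrMap j) (U.arrMap (J.vcomp i j))
        (U.arrMap_vcomp i j).symm 𝓜 (s d).hom ((hX d).alg (J.ar i)) (alg (J.ar i))
        (((s d).Kmap_wMap (J.ar i)).trans (congrArg _ (hl (J.ar i)))))
    exact (congrArg _ ((hl (J.ar (J.vcomp i j))).trans (hl (J.ar j)).symm)).trans key.symm

end Pitchfork

/-! ### Cocontinuity of the monad of the factorisation system. -/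

section Cocontinuous

variable {C : Type u₂} [Category.{v₂} C] {𝒟 : Type u₃} [Category.{v₃} 𝒟]

/-- Colimits of arrows are componentwise. -/
noncomputable def arrowIsColimit {F : 𝒟 ⥤ Arrow C} {c : Cocone F}
    (hl : IsColimit (Arrow.leftFunc.mapCocone c)) (hr : IsColimit (Arrow.rightFunc.mapCocone c)) :
    IsColimit c :=
  Comma.fstSndJointlyReflectColimit hl hr

variable {V : Type u₁} [Category.{v₁} V] [MonoidalCategory V] [HasPullbacks V]
  [EnrichedOrdinaryCategory V C]

/-- The domain of $\rho_f$ is $Kf$, and `K` preserves the colimit; its codomain is that of `f`,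
which is covered by `hr`. This yields the joint epimorphicity on $K\rho_f$ needed for associativity.
-/
lemma FunctorialFactorisation.nonempty_isColimit_R (𝓕 : FunctorialFactorisation V C)
    [PreservesColimitsOfShape 𝒟 (underlying 𝓕.K)] {F : 𝒟 ⥤ Arrow C} {c : Cocone F}
    (hc : IsColimit c) (hr : IsColimit (Arrow.rightFunc.mapCocone c)) :
    Nonempty (IsColimit ((underlying 𝓕.R).mapCocone c)) := by
  let el : underlying 𝓕.K ≅ underlying 𝓕.R ⋙ Arrow.leftFunc :=
    NatIso.ofComponents (fun _ => Iso.refl _) fun s =>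
      (Category.comp_id _).trans ((congrArg CommaMorphism.left (𝓕.mapHom_R s)).symm.trans
        (Category.id_comp _).symm)
  let er : Arrow.rightFunc ≅ underlying 𝓕.R ⋙ Arrow.rightFunc :=
    NatIso.ofComponents (fun _ => Iso.refl _) fun s =>
      (Category.comp_id _).trans ((congrArg CommaMorphism.right (𝓕.mapHom_R s)).symm.trans
        (Category.id_comp _).symm)
  exact ⟨arrowIsColimit (IsColimit.mapCoconeEquiv el (isColimitOfPreserves (underlying 𝓕.K) hc))
    (IsColimit.mapCoconeEquiv er hr)⟩

end Cocontinuous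

/-! ### Colimits preserved by $W_i$, $K W_i$ and $K\rho_{W_i}$. -/

section Pitchfork

variable {V : Type u₁} [Category.{v₁} V] [MonoidalCategory V] [MonoidalClosed V] [HasPullbacks V]
variable {C : Type u₂} [Category.{v₂} C] [EnrichedOrdinaryCategory V C]

/-- The domain of `C(cod g, dom f) ⟶ C^2(g, f)` as a functor of `f`. -/
noncomputable def diagCovLeftIso (g : Arrow C) :
    Arrow.leftFunc ⋙ (eHomFunctor V C).obj (op g.right) ≅
      underlying (diagCov V g) ⋙ Arrow.leftFunc :=
  NatIso.ofComponents (fun _ => Iso.refl _) fun s =>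
    (Category.comp_id _).trans ((mapHom_diagCov_left (V := V) g s).symm.trans
      (Category.id_comp _).symm)

/-- The codomain of `C(cod g, dom f) ⟶ C^2(g, f)` as a functor of `f`. -/
noncomputable def diagCovRightIso (g : Arrow C) :
    (eHomFunctor V (Arrow C)).obj (op g) ≅ underlying (diagCov V g) ⋙ Arrow.rightFunc :=
  NatIso.ofComponents (fun _ => Iso.refl _) fun s =>
    (Category.comp_id _).trans ((mapHom_diagCov_right (V := V) g s).symm.trans
      (Category.id_comp _).symm)

variable {𝒟 : Type u₃} [Category.{v₃} 𝒟] {F : 𝒟 ⥤ Arrow C} {c : Cocone F}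

/-- `c` is sent to colimits by the representables that occur in
`f ↦ (C(cod g, dom f) ⟶ C^2(g, f))`. -/
structure IsDiagColimit (V : Type u₁) [Category.{v₁} V] [MonoidalCategory V] [MonoidalClosed V]
    [HasPullbacks V] [EnrichedOrdinaryCategory V C] (g : Arrow C) (c : Cocone F) : Prop where
  left : Nonempty (IsColimit (((eHomFunctor V C).obj (op g.right)).mapCocone
    (Arrow.leftFunc.mapCocone c)))
  right : Nonempty (IsColimit (((eHomFunctor V (Arrow C)).obj (op g)).mapCocone c))

namespace IsDiagColimit

variable {g : Arrow C}

lemma nonempty_isColimit_left (h : IsDiagColimit V g c) :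
    Nonempty (IsColimit (Arrow.leftFunc.mapCocone ((underlying (diagCov V g)).mapCocone c))) :=
  ⟨IsColimit.mapCoconeEquiv (diagCovLeftIso g) h.left.some⟩

lemma nonempty_isColimit_right (h : IsDiagColimit V g c) :
    Nonempty (IsColimit (Arrow.rightFunc.mapCocone ((underlying (diagCov V g)).mapCocone c))) :=
  ⟨IsColimit.mapCoconeEquiv (diagCovRightIso g) h.right.some⟩

lemma nonempty_isColimit (h : IsDiagColimit V g c) :
    Nonempty (IsColimit ((underlying (diagCov V g)).mapCocone c)) :=
  ⟨arrowIsColimit h.nonempty_isColimit_left.some h.nonempty_isColimit_right.some⟩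

variable (𝓜 : AWFS V V) [PreservesColimitsOfShape 𝒟 (underlying 𝓜.K)]

lemma nonempty_isColimit_K (h : IsDiagColimit V g c) : Nonempty (IsColimit
    ((underlying 𝓜.K).mapCocone ((underlying (diagCov V g)).mapCocone c))) :=
  ⟨isColimitOfPreserves _ h.nonempty_isColimit.some⟩

lemma nonempty_isColimit_R_K (h : IsDiagColimit V g c) :
    Nonempty (IsColimit ((underlying 𝓜.K).mapCocone
    ((underlying 𝓜.R).mapCocone ((underlying (diagCov V g)).mapCocone c)))) :=
  ⟨isColimitOfPreserves _ (𝓜.nonempty_isColimit_R h.nonempty_isColimit.some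
    h.nonempty_isColimit_right.some).some⟩

/-- This and the next two lemmas supply the three joint epimorphicity hypotheses of
`IsPitchfork.of_jointly_epi`. -/
lemma hom_ext_left (h : IsDiagColimit V g c) {Z : V} {a b : (g.right ⟶[V] c.pt.left) ⟶ Z}
    (hab : ∀ d, (mapHom (diagCov V g) (c.ι.app d)).left ≫ a =
      (mapHom (diagCov V g) (c.ι.app d)).left ≫ b) : a = b :=
  h.nonempty_isColimit_left.some.hom_ext hab

lemma hom_ext_K (h : IsDiagColimit V g c) {Z : V}
    {a b : 𝓜.K.obj (Arrow.mk (arrowDiag V g c.pt)) ⟶ Z}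
    (hab : ∀ d, 𝓜.Kmap (mapHom (diagCov V g) (c.ι.app d)) ≫ a =
      𝓜.Kmap (mapHom (diagCov V g) (c.ι.app d)) ≫ b) : a = b :=
  (h.nonempty_isColimit_K 𝓜).some.hom_ext hab

lemma hom_ext_R_K (h : IsDiagColimit V g c) {Z : V}
    {a b : 𝓜.K.obj (Arrow.mk (𝓜.rho (Arrow.mk (arrowDiag V g c.pt)))) ⟶ Z}
    (hab : ∀ d, 𝓜.Kmap (𝓜.Rmap (mapHom (diagCov V g) (c.ι.app d))) ≫ a =
      𝓜.Kmap (𝓜.Rmap (mapHom (diagCov V g) (c.ι.app d))) ≫ b) : a = b :=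
  (h.nonempty_isColimit_R_K 𝓜).some.hom_ext fun d =>
    (congrArg (fun t => 𝓜.Kmap t ≫ a) (𝓜.mapHom_R _)).trans ((hab d).trans
      (congrArg (fun t => 𝓜.Kmap t ≫ b) (𝓜.mapHom_R _)).symm)

end IsDiagColimit

end Pitchfork

/-! ### Lifting the colimit cocone. -/

section Creation

variable {V : Type u₁} [Category.{v₁} V] [MonoidalCategory V] [MonoidalClosed V] [HasPullbacks V]
variable {C : Type u₂} [Category.{v₂} C] [EnrichedOrdinaryCategory V C]
variable {J : InternalCat.{v₁, u₁, w} V} {𝓜 : AWFS V V} {U : J.ToSq C}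

lemma Inserter.Hom.comm_of_Kmap_wMap {x y : Inserter (srcStr 𝓜 U) (tgtStr (V := V) U)}
    {s : x.obj ⟶ y.obj} {i : J.Arr}
    (h : 𝓜.Kmap (wMap U i s) ≫ y.str i = x.str i ≫ (wMap U i s).left) :
    mapHom (srcStr 𝓜 U i) s ≫ y.str i = x.str i ≫ mapHom (tgtStr (V := V) U i) s := by
  rw [mapHom_srcStr, mapHom_tgtStr]
  exact h

variable [BraidedCategory V]
variable {𝒟 : Type w'} [SmallCategory 𝒟] [PreservesColimitsOfShape 𝒟 (underlying 𝓜.K)]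
  {D : 𝒟 ⥤ Pitchfork 𝓜 U}

/-- The structures of the diagram, followed by the domain parts of the legs, form a cocone since the
transition maps are algebra morphisms; it descends because $K W_i$ preserves the colimit. -/
lemma exists_pitchfork_str {c : Cocone (D ⋙ pitchforkForget 𝓜 U)} {i : J.Arr}
    (h : IsDiagColimit V (U.arrFunctor.obj i) c) :
    ∃ p : 𝓜.K.obj (wArr U i c.pt) ⟶ (wArr U i c.pt).left, ∀ d,
      𝓜.Kmap (wMap U i (c.ι.app d)) ≫ p = (D.obj d).obj.str i ≫ (wMap U i (c.ι.app d)).left := by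
  let t : Cocone ((D ⋙ pitchforkForget 𝓜 U) ⋙
      underlying (diagCov V (U.arrFunctor.obj i)) ⋙ underlying 𝓜.K) :=
    { pt := (wArr U i c.pt).left
      ι := { app := fun d => (D.obj d).obj.str i ≫ (wMap U i (c.ι.app d)).left
             naturality := fun d d' φ => by
               have h1 := (D.map φ).hom.Kmap_wMap i
               have h2 : wMap U i (D.map φ).hom.hom ≫ wMap U i (c.ι.app d') =
                   wMap U i (c.ι.app d) :=
                 (mapHom_comp (diagCov V (U.arrFunctor.obj i)) _ _).symm.trans
                   (congrArg _ (c.w φ))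
               refine (Category.assoc _ _ _).symm.trans ((congrArg (· ≫ _) h1).trans ?_)
               refine (Category.assoc _ _ _).trans (Eq.trans ?_ (Category.comp_id _).symm)
               exact congrArg _ (congrArg CommaMorphism.left h2) } }
  exact ⟨(h.nonempty_isColimit_K 𝓜).some.desc t, (h.nonempty_isColimit_K 𝓜).some.fac t⟩

lemma existsUnique_cocone_pitchfork {c : Cocone (D ⋙ pitchforkForget 𝓜 U)}
    (h : ∀ i, IsDiagColimit V (U.arrFunctor.obj i) c) :
    ∃! c' : Cocone D, (pitchforkForget 𝓜 U).mapCocone c' = c := by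
  choose p hp using fun i => exists_pitchfork_str (h i)
  let x : Inserter (srcStr 𝓜 U) (tgtStr (V := V) U) := ⟨c.pt, p⟩
  let s (d : 𝒟) : (D.obj d).obj ⟶ x :=
    ⟨c.ι.app d, fun i => Inserter.Hom.comm_of_Kmap_wMap (y := x) (hp i d)⟩
  have hx : IsPitchfork 𝓜 U x := IsPitchfork.of_jointly_epi (fun d => (D.obj d).property) s
    (fun i _ _ _ => (h i).hom_ext_left) (fun i _ _ _ => (h i).hom_ext_K 𝓜)
    fun i _ _ _ => (h i).hom_ext_R_K 𝓜
  let c₁ : Cocone D :=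
    { pt := ⟨x, hx⟩
      ι := { app := fun d => ObjectProperty.homMk (s d)
             naturality := fun d d' φ => ObjectProperty.hom_ext _
               (Inserter.Hom.ext (c.ι.naturality φ)) } }
  refine ⟨c₁, rfl, fun c' hc' => ?_⟩
  subst hc'
  -- A lift of `c` has no freedom except in the structure on its vertex, and the legs being
  -- morphisms of the inserter determines that on a jointly epimorphic family. The rest is
  -- propositional.
  obtain rfl : c'.pt.obj.str = p := funext fun i => (h i).hom_ext_K 𝓜 fun d =>
    (((c'.ι.app d).hom.Kmap_wMap i).trans (hp i d).symm)
  rfl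

/-- The source functors of the inserter are $K W_i$, whose values on the legs are jointly
epimorphic, and by closedness of $\mathcal V$ also in the enriched sense. -/
lemma isConicalColimit_pitchfork [HasEqualizers V] [HasProductsOfShape J.Arr V] {c : Cocone D}
    (h₁ : IsConicalColimit V ((pitchforkForget 𝓜 U).mapCocone c))
    (h₂ : ∀ i, IsDiagColimit V (U.arrFunctor.obj i) ((pitchforkForget 𝓜 U).mapCocone c)) :
    IsConicalColimit V c := by
  refine Inserter.isConicalColimit_fullSubcategory h₁ fun i T Z a b hab => ?_
  have hab (d : 𝒟) : a ≫ eHomWhiskerRight V (𝓜.Kmap (wMap U i (c.ι.app d).hom.hom)) Z =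
      b ≫ eHomWhiskerRight V (𝓜.Kmap (wMap U i (c.ι.app d).hom.hom)) Z :=
    (congrArg (fun t => a ≫ eHomWhiskerRight V t Z) (mapHom_srcStr 𝓜 U i _).symm).trans
      ((hab d).trans (congrArg (fun t => b ≫ eHomWhiskerRight V t Z) (mapHom_srcStr 𝓜 U i _)))
  have hm (Z : V) (a b : 𝓜.K.obj (wArr U i c.pt.obj.obj) ⟶ Z)
      (h : ∀ d, 𝓜.Kmap (wMap U i (c.ι.app d).hom.hom) ≫ a =
        𝓜.Kmap (wMap U i (c.ι.app d).hom.hom) ≫ b) : a = b :=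
    (h₂ i).hom_ext_K 𝓜 h
  exact eHomWhiskerRight_jointly_mono (K := fun d => 𝓜.K.obj (wArr U i (D.obj d).obj.obj))
    (K' := 𝓜.K.obj (wArr U i c.pt.obj.obj))
    (fun d => 𝓜.Kmap (wMap U i (c.ι.app d).hom.hom)) hm (T := T) (Z := Z) a b hab

lemma createsConicalColimit_pitchforkForget [HasEqualizers V] [HasProductsOfShape J.Arr V]
    (hD : ∀ c : Cocone (D ⋙ pitchforkForget 𝓜 U), IsColimit c → IsConicalColimit V c ∧
      ∀ i, IsDiagColimit V (U.arrFunctor.obj i) c) :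
    CreatesConicalColimit V (pitchforkForget 𝓜 U) D := by
  intro c hc
  obtain ⟨h₁, h₂⟩ := hD c hc.some
  refine ⟨existsUnique_cocone_pitchfork h₂, fun c' hc' => ?_⟩
  subst hc'
  exact isConicalColimit_pitchfork h₁ h₂

end Creation

/-! ### The choice of the cardinal. -/

section Base

variable (P : ObjectProperty Cat.{u, u}) [IsBase P]
variable {C : Type w} [Category.{u} C] [EnrichedOrdinaryCategory P.FullSubcategory C]

/-- The tensors $[n]\otimes A_i$ with $n\le 2$ form a small family, so one cardinal bounds their
ranks. -/
lemma exists_hasRankLE_tensor {M : MorphismProperty C}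
    (hC : IsCocomplete.{u, u + 1, u, w, u} P.FullSubcategory C)
    (h : ∀ A : C, ∃ (κ : Cardinal.{u}) (_ : Fact κ.IsRegular), HasRankLE M A κ)
    {I : Type u} (A : I → C) :
    ∃ (κ : Cardinal.{u}) (_ : Fact κ.IsRegular), ∀ (i : I) (n : Fin 3), ∃ T : C,
      HasRankLE M T κ ∧ Nonempty (coyoneda.obj (op T) ≅
        (eHomFunctor P.FullSubcategory C).obj (op (A i)) ⋙
          coyoneda.obj (op (ordBase P n))) := by
  choose T η hT using fun (i : I) (n : Fin 3) => hC.exists_tensor (ordBase P n) (A i)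
  obtain ⟨κ, hκ, hr⟩ := exists_hasRankLE_forall h fun x : I × Fin 3 => T x.1 x.2
  exact ⟨κ, hκ, fun i n => ⟨T i n, hr (i, n), nonempty_coyoneda_iso_of_tensor _ (hT i n)⟩⟩

variable {P} in
-- The functor $\mathcal V(T',\mathcal C(A,-))$ is represented by a tensor of rank at most $\kappa$.
-- The cocone `m` only makes the rank applicable; the colimit `c` may be any other cocone.
lemma nonempty_isColimit_of_tensor {M : MorphismProperty C} {κ : Cardinal.{u}} [Fact κ.IsRegular]
    {𝒟 : Type u} [SmallCategory 𝒟] [IsCardinalFiltered 𝒟 κ] {X : 𝒟 ⥤ C} (m : Cocone X)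
    (hm : ∀ d, M (m.ι.app d)) {c : Cocone X} (hc : IsColimit c) {A : C} {T' : P.FullSubcategory}
    (hA : ∃ T : C, HasRankLE M T κ ∧ Nonempty (coyoneda.obj (op T) ≅
      (eHomFunctor P.FullSubcategory C).obj (op A) ⋙ coyoneda.obj (op T'))) :
    Nonempty (IsColimit (((eHomFunctor P.FullSubcategory C).obj (op A) ⋙
      coyoneda.obj (op T')).mapCocone c)) := by
  obtain ⟨T, hT, ⟨e⟩⟩ := hA
  have := hT 𝒟 X m hm
  exact ⟨IsColimit.mapCoconeEquiv e (isColimitOfPreserves _ hc)⟩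

end Base

end EnrichedAWFS

theorem mainTheorem7 (P : ObjectProperty Cat.{u, u}) [IsBase P]
    (𝓜 : AWFS P.FullSubcategory P.FullSubcategory)
    (h𝓜 : AWFS.Cocontinuous.{u, u + 1, u, u + 1, u} 𝓜)
    {C : Type w} [Category.{u} C] [EnrichedOrdinaryCategory P.FullSubcategory C]
    (hC : IsCocomplete.{u, u + 1, u, w, u} P.FullSubcategory C)
    (E M : MorphismProperty C) (hEM : IsLocallyRanked.{u, w, u} E M)
    (J : InternalCat.{u, u + 1, u} P.FullSubcategory) (U : J.ToSq C) :
    ∃ (κ : Cardinal.{u}) (_ : Fact κ.IsRegular),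
      ∀ (𝒟 : Type u) [SmallCategory 𝒟] [IsCardinalFiltered 𝒟 κ]
        (D : 𝒟 ⥤ Pitchfork 𝓜 U) (m : Cocone (D ⋙ pitchforkForget 𝓜 U)),
        (∀ d, M (m.ι.app d).left ∧ M (m.ι.app d).right) →
          CreatesConicalColimit P.FullSubcategory (pitchforkForget 𝓜 U) D := by
  obtain ⟨κ, hκ, hr⟩ := exists_hasRankLE_tensor P hC hEM.exists_rank
    -- Domains and codomains of all $Ui$ are put in one family, with `true` for domains, so that a
    -- single `κ` serves both.
    fun x : J.Arr × Bool => if x.2 then (U.arrFunctor.obj x.1).left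
      else (U.arrFunctor.obj x.1).right
  have hrl (i : J.Arr) := hr (i, true)
  have hrr (i : J.Arr) := hr (i, false)
  simp only [if_true, Bool.false_eq_true, if_false] at hrl hrr
  refine ⟨κ, hκ, fun 𝒟 _ _ D m hm => ?_⟩
  have : IsFiltered 𝒟 := isFiltered_of_isCardinalFiltered 𝒟 κ
  have := hEM.hasColimits
  have : PreservesColimitsOfShape 𝒟 (underlying 𝓜.K) := h𝓜.preservesColimitsOfShape
  refine createsConicalColimit_pitchforkForget fun c hc => ?_
  -- Since `C` has small colimits, those of arrows are computed on domains and codomains.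
  have hl : IsColimit (Arrow.leftFunc.mapCocone c) := isColimitOfPreserves _ hc
  have hr : IsColimit (Arrow.rightFunc.mapCocone c) := isColimitOfPreserves _ hc
  refine ⟨?_, fun i => ?_⟩
  · obtain ⟨cl, hcl⟩ := hC.exists_conicalColimit ((D ⋙ pitchforkForget 𝓜 U) ⋙ Arrow.leftFunc)
    obtain ⟨cr, hcr⟩ := hC.exists_conicalColimit ((D ⋙ pitchforkForget 𝓜 U) ⋙ Arrow.rightFunc)
    exact .arrow (hcl.of_isColimit hl) (hcr.of_isColimit hr)
  · have hml (d : 𝒟) : M ((Arrow.leftFunc.mapCocone m).ι.app d) := (hm d).1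
    have hmr (d : 𝒟) : M ((Arrow.rightFunc.mapCocone m).ι.app d) := (hm d).2
    refine ⟨nonempty_isColimit_of_ordBase P _ fun n =>
        nonempty_isColimit_of_tensor _ hml hl (hrr i n),
      nonempty_isColimit_of_ordBase P _ fun n => ?_⟩
    -- The three corners of the pullback that defines $\mathcal C^{\mathbf 2}(Ui,-)$: two involve
    -- $\mathrm{dom}\,Ui$ and one involves $\mathrm{cod}\,Ui$.
    exact nonempty_isColimit_arrowHom c (U.arrFunctor.obj i) (ordBase P n)
      (nonempty_isColimit_of_tensor _ hml hl (hrl i n)).some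
      (nonempty_isColimit_of_tensor _ hmr hr (hrl i n)).some
      (nonempty_isColimit_of_tensor _ hmr hr (hrr i n)).some
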